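/- **Theorem 1.1.** Let $p$ be a prime and $n\ge 1$. Let $\mu_{p^n}$ be the group of $p^n$-th roots of unity, $\zeta$ a primitive $p^n$-th root of unity, $R_n=\mathbb Z[\mu_{p^n},\tfrac1p]$, and $G_n=\mathrm{Gal}(\mathbb Q(\mu_{p^n})/\mathbb Q)$; for $a$ prime to $p$ let $\sigma_a\in G_n$ be the automorphism with $\sigma_a(\zeta)=\zeta^a$. Let $K_2^M(R_n)$ be the quotient of $R_n^\times\otimes_{\mathbb Z}R_n^\times$ by the subgroup generated by all $a\otimes b$ with $a+b\in\{0,1\}$, let $\{a,b\}$ denote the class of $a\otimes b$, and let $\tilde K_2(R_n)$ be the quotient of $K_2^M(R_n)$ by the subgroup of elements killed by $2$. Let $\Sigma_0(p^n)$ be the semigroup of integral matrices $\begin{pmatrix}a&b\\c&d\end{pmatrix}$ of positive determinant with $(a,p)=1$ and $p^n\mid c$; it acts on the right on $\tilde K_2(R_n)$ by $m|\delta=\sigma_a(m)$, $a$ being the upper left entry of $\delta$. Write $\Gamma_0=\Gamma_0(p^n)\subseteq\Sigma_0(p^n)$, and let $\Delta_0$ be the group of divisors of degree $0$ on $\mathbb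 P^1(\mathbb Q)$. A modular symbol is a homomorphism $\phi:\Delta_0\to\tilde K_2(R_n)$ with $\phi(\gamma D)|\gamma=\phi(D)$ for all $\gamma\in\Gamma_0$, $D\in\Delta_0$. There is a unique modular symbol $\phi_n$ such that, for every $\gamma\in SL_2(\mathbb Z)$ with bottom row congruent to $(x,y)$ modulo $p^n$, $$\phi_n\bigl(\gamma((\infty)-(0))\bigr)=\begin{cases}\{1-\zeta^x,\,1-\zeta^y\}&\text{if }x\not\equiv0\text{ and }y\not\equiv0\pmod{p^n},\\0&\text{otherwise.}\end{cases}$$ Let $H^1_{par}(\Gamma_0,\tilde K_2(R_n))$ be the group of classes in $H^1(\Gamma_0,\tilde K_2(R_n))$ (for the left action $\gamma\cdot m=m|\gamma^{-1}$) whose restriction to the stabilizer in $\Gamma_0$ of every $r\in\mathbb P^1(\mathbb Q)$ is trivial. Let $G_n$ act on it through the coefficients, and let $T_m$ be the Hecke operator of the double coset $\Gamma_0\begin{pmatrix}1&0\\0&m\end{pmatrix}\Gamma_0$, given on $1$-cocycles by $(c|T_m)(\gamma)=\sum_i c(\gamma_i)|\delta_i$, where $\{\delta_i\}$ represents the cosets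 $\Gamma_0\delta$ in the double coset and $\delta_i\gamma=\gamma_i\delta_{j(i)}$ with $\gamma_i\in\Gamma_0$. Let $\varphi_n\in H^1_{par}(\Gamma_0,\tilde K_2(R_n))$ be the class of the cocycle $\gamma\mapsto\phi_n\bigl((\gamma\infty)-(\infty)\bigr)$. Then 1. $\varphi_n|T_2=(\sigma_2+2)\varphi_n$ if $p\ne2$; and 2. $\varphi_n|T_3=(\sigma_3+3)\varphi_n$ if $p\ne3$. -/

import Mathlib

noncomputable section

open Matrix CongruenceSubgroup MulOpposite
open scoped MatrixGroups TensorProduct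

namespace SteinbergSymbol

/-! ### The semigroup `Σ₀(N)` and the group `Γ₀(N)` -/

/-- `Σ₀(N)`: integral `2 × 2` matrices of positive determinant whose upper left entry is prime to
`N` and whose lower left entry is divisible by `N`. -/
def Sigma0 (N : ℕ) : Submonoid (Matrix (Fin 2) (Fin 2) ℤ) where
  carrier := {δ | 0 < δ.det ∧ IsCoprime (δ 0 0) (N : ℤ) ∧ (N : ℤ) ∣ δ 1 0}
  one_mem' := by simp [isCoprime_one_left]
  mul_mem' := by
    rintro a b ⟨ha, ha', ha''⟩ ⟨hb, hb', hb''⟩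
    refine ⟨by rw [det_mul]; positivity, ?_, ?_⟩
    · rw [Matrix.mul_apply, Fin.sum_univ_two]
      obtain ⟨k, hk⟩ := hb''
      rw [hk, mul_left_comm]
      exact (ha'.mul_left hb').add_mul_left_left _
    · rw [Matrix.mul_apply, Fin.sum_univ_two]
      exact dvd_add (ha''.mul_right _) (hb''.mul_left _)

/-- The inclusion of `Γ₀(N)` into `Σ₀(N)`. -/
def gammaToSigma (N : ℕ) : Gamma0 N →* Sigma0 N where
  toFun γ := ⟨(γ : SL(2, ℤ)), by
    have h : (N : ℤ) ∣ (γ : SL(2, ℤ)) 1 0 :=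
      (ZMod.intCast_zmod_eq_zero_iff_dvd _ _).1 (Gamma0_mem.1 γ.2)
    refine ⟨by simp, ?_, h⟩
    obtain ⟨k, hk⟩ := h
    have hd := (γ : SL(2, ℤ)).det_coe
    rw [det_fin_two, hk] at hd
    exact ⟨(γ : SL(2, ℤ)) 1 1, -((γ : SL(2, ℤ)) 0 1 * k), by linarith⟩⟩
  map_one' := by ext; simp
  map_mul' γ γ' := by ext; simp

variable {N : ℕ}

theorem det_ne_zero_of_sigma (δ : Sigma0 N) : (δ : Matrix (Fin 2) (Fin 2) ℤ).det ≠ 0 :=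
  δ.2.1.ne'

/-- A matrix in `Σ₀(N)`, seen in `GL₂(ℚ)`. -/
def toGL (N : ℕ) : Sigma0 N →* GL (Fin 2) ℚ where
  toFun δ := GeneralLinearGroup.mkOfDetNeZero
    ((δ : Matrix (Fin 2) (Fin 2) ℤ).map (Int.castRingHom ℚ)) (by
      rw [← RingHom.mapMatrix_apply, ← RingHom.map_det]
      exact (map_ne_zero_iff _ (RingHom.injective_int _)).2 (det_ne_zero_of_sigma δ))
  map_one' := by
    apply Units.ext
    simp [GeneralLinearGroup.mkOfDetNeZero]
  map_mul' δ δ' := by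
    apply Units.ext
    change ((δ * δ' : Matrix (Fin 2) (Fin 2) ℤ)).map _ = _ * _
    rw [Matrix.map_mul]
    rfl

/-! ### Divisors on the projective line -/

/-- The group `Δ₀` of divisors of degree zero on `ℙ¹(ℚ) = ℚ ∪ {∞}`. -/
def Div0 : Submodule ℤ (OnePoint ℚ →₀ ℤ) :=
  LinearMap.ker (Finsupp.linearCombination ℤ (fun _ : OnePoint ℚ => (1 : ℤ)))

/-- The divisor `(r) - (s)`. -/
def divSub (r s : OnePoint ℚ) : Div0 :=
  ⟨Finsupp.single r 1 - Finsupp.single s 1, by simp [Div0]⟩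

/-- The action of `GL₂(ℚ)` on `Δ₀` by fractional linear transformations. -/
def actDiv (g : GL (Fin 2) ℚ) : Div0 →ₗ[ℤ] Div0 :=
  (Finsupp.lmapDomain ℤ ℤ (fun r : OnePoint ℚ => g • r)).restrict (by
    intro D hD
    rw [Div0, LinearMap.mem_ker] at hD ⊢
    rw [Finsupp.lmapDomain_apply, Finsupp.linearCombination_mapDomain]
    exact hD)

theorem actDiv_divSub (g : GL (Fin 2) ℚ) (r s : OnePoint ℚ) :
    actDiv g (divSub r s) = divSub (g • r) (g • s) := by
  apply Subtype.ext
  rw [actDiv, LinearMap.coe_restrict_apply]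
  change Finsupp.lmapDomain ℤ ℤ _ (Finsupp.single r 1 - Finsupp.single s 1) = _
  rw [map_sub]
  simp [divSub]

theorem divSub_add (r s t : OnePoint ℚ) : divSub r s + divSub s t = divSub r t := by
  apply Subtype.ext
  change (_ - _) + (_ - _) = (_ - _ : OnePoint ℚ →₀ ℤ)
  abel

/-! ### Right `Σ₀(N)`-modules, modular symbols -/

section Module

/- A right `Σ₀(N)`-module `M` is a representation `ρ` of the opposite monoid, `m|δ` being
`ρ (op δ) m`. -/
variable {M : Type} [AddCommGroup M] (ρ : Representation ℤ (Sigma0 N)ᵐᵒᵖ M)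

/-- The group of `M`-valued modular symbols over `Γ₀(N)`: the homomorphisms `φ : Δ₀ → M` with
`φ|γ = φ` for all `γ ∈ Γ₀(N)`, where `(φ|γ)(D) = φ(γ D)|γ`. -/
def Symb : Submodule ℤ (Div0 →ₗ[ℤ] M) where
  carrier := {φ | ∀ (γ : Gamma0 N) (D : Div0),
    ρ (op (gammaToSigma N γ)) (φ (actDiv (toGL N (gammaToSigma N γ)) D)) = φ D}
  zero_mem' := by simp
  add_mem' := by
    intro a b ha hb γ D
    simp [ha γ D, hb γ D]
  smul_mem' := by
    intro c a ha γ D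
    simp only [LinearMap.smul_apply, map_smul]
    rw [ha γ D]

/-- The right action of `Γ₀(N)` on `M`, turned into a left action by `γ • m = m|γ⁻¹`. -/
def leftRep : Representation ℤ (Gamma0 N) M where
  toFun γ := ρ (op (gammaToSigma N γ⁻¹))
  map_one' := by simp
  map_mul' γ γ' := by simp

theorem leftRep_apply (γ : Gamma0 N) (m : M) :
    leftRep ρ γ m = ρ (op (gammaToSigma N γ⁻¹)) m := rfl

theorem act_act (δ δ' : Sigma0 N) (m : M) :
    ρ (op δ') (ρ (op δ) m) = ρ (op (δ * δ')) m := by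
  rw [op_mul, map_mul]; rfl

theorem Symb.apply_act (φ : Symb ρ) (γ : Gamma0 N) (D : Div0) :
    φ.1 (actDiv (toGL N (gammaToSigma N γ)) D) = leftRep ρ γ (φ.1 D) := by
  rw [← φ.2 γ D, leftRep_apply, act_act, ← map_mul, mul_inv_cancel, map_one, op_one, map_one]
  rfl

/-- `M`, as an object of the category of `Γ₀(N)`-modules. -/
abbrev coeff : Rep ℤ (Gamma0 N) := Rep.of (leftRep ρ)

/-- `H¹(Γ₀(N), M)`. -/
abbrev H1 : Type := groupCohomology.H1 (coeff ρ)

/-- The stabilizer `Γ_r` in `Γ₀(N)` of the cusp `r ∈ ℙ¹(ℚ)`. -/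
def cuspStabilizer (N : ℕ) (r : OnePoint ℚ) : Subgroup (Gamma0 N) :=
  (MulAction.stabilizer (GL (Fin 2) ℚ) r).comap ((toGL N).comp (gammaToSigma N))

theorem mem_cuspStabilizer (r : OnePoint ℚ) (γ : Gamma0 N) :
    γ ∈ cuspStabilizer N r ↔ toGL N (gammaToSigma N γ) • r = r := Iff.rfl

/-- The parabolic cohomology group `H¹_par(Γ₀(N), M)`: the classes in `H¹(Γ₀(N), M)` whose
restriction to the stabilizer of every cusp is trivial. -/
def H1par : Submodule ℤ (H1 ρ) :=
  ⨅ r : OnePoint ℚ, LinearMap.ker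
    (groupCohomology.map (A := coeff ρ) (B := Rep.res (cuspStabilizer N r).subtype (coeff ρ))
      (cuspStabilizer N r).subtype (CategoryTheory.CategoryStruct.id _) 1).hom

/-- The class of a cocycle. -/
def classOf : groupCohomology.cocycles₁ (coeff ρ) →ₗ[ℤ] H1 ρ :=
  (groupCohomology.H1π (coeff ρ)).hom

theorem classOf_surjective : Function.Surjective (classOf ρ) := fun x => by
  induction x using groupCohomology.H1_induction_on with
  | h x => exact ⟨x, rfl⟩

theorem classOf_eq_zero_iff (c : groupCohomology.cocycles₁ (coeff ρ)) :
    classOf ρ c = 0 ↔ ∃ v : M, ∀ γ : Gamma0 N, c γ = leftRep ρ γ v - v := by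
  refine (groupCohomology.H1π_eq_zero_iff c).trans ⟨?_, ?_⟩
  · rintro ⟨v, hv⟩
    exact ⟨v, fun γ => (congrFun hv γ).symm⟩
  · rintro ⟨v, hv⟩
    exact ⟨v, funext fun γ => (hv γ).symm⟩

theorem classOf_mem_H1par_iff (c : groupCohomology.cocycles₁ (coeff ρ)) :
    classOf ρ c ∈ H1par ρ ↔
      ∀ r : OnePoint ℚ, ∃ v : M, ∀ γ ∈ cuspStabilizer N r, c γ = leftRep ρ γ v - v := by
  rw [H1par, Submodule.mem_iInf]
  refine forall_congr' fun r => ?_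
  rw [LinearMap.mem_ker]
  have h := groupCohomology.H1π_comp_map_apply (A := coeff ρ)
    (B := Rep.res (cuspStabilizer N r).subtype (coeff ρ))
    (cuspStabilizer N r).subtype (CategoryTheory.CategoryStruct.id _) c
  change (groupCohomology.map _ _ 1).hom ((groupCohomology.H1π (coeff ρ)).hom c) = _ at h
  rw [classOf, h]
  refine (groupCohomology.H1π_eq_zero_iff _).trans ⟨?_, ?_⟩
  · rintro ⟨v, hv⟩
    exact ⟨v, fun γ hγ => (congrFun hv ⟨γ, hγ⟩).symm⟩
  · rintro ⟨v, hv⟩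
    exact ⟨v, funext fun γ => (hv γ.1 γ.2).symm⟩

/-- The `1`-cocycle `γ ↦ φ((γ ∞) - (∞))` of a modular symbol `φ`. -/
def symbCocycle : Symb ρ →ₗ[ℤ] groupCohomology.cocycles₁ (coeff ρ) where
  toFun φ := ⟨fun γ => φ.1 (divSub (toGL N (gammaToSigma N γ) • OnePoint.infty) OnePoint.infty),
    (groupCohomology.mem_cocycles₁_iff _).2 fun γ γ' => by
      change _ = leftRep ρ γ _ + _
      rw [← Symb.apply_act, actDiv_divSub, ← map_add, divSub_add, map_mul, map_mul, mul_smul]⟩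
  map_add' _ _ := rfl
  map_smul' _ _ := rfl

/-- The canonical map from modular symbols to parabolic cohomology, sending `φ` to the class of
the cocycle `γ ↦ φ((γ ∞) - (∞))`. -/
def symbToPar : Symb ρ →ₗ[ℤ] H1par ρ :=
  (classOf ρ ∘ₗ symbCocycle ρ).codRestrict (H1par ρ) fun φ => by
    refine (classOf_mem_H1par_iff ρ _).2 fun r => ⟨φ.1 (divSub OnePoint.infty r), fun γ hγ => ?_⟩
    rw [mem_cuspStabilizer] at hγ
    change φ.1 (divSub _ _) = _
    rw [← Symb.apply_act, actDiv_divSub, hγ, ← map_sub]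
    congr 1
    rw [eq_sub_iff_add_eq, add_comm]
    apply Subtype.ext
    change (_ - _) + (_ - _) = (_ - _ : OnePoint ℚ →₀ ℤ)
    abel

/-! ### Functoriality in the coefficients -/

variable {ρ}

/-- The endomorphism of `H¹(Γ₀(N), M)` induced by an endomorphism of `M` that commutes with
`Σ₀(N)`. -/
def coeffH1 (f : M →ₗ[ℤ] M) (hf : ∀ δ m, f (ρ δ m) = ρ δ (f m)) : H1 ρ →ₗ[ℤ] H1 ρ :=
  (groupCohomology.map (A := coeff ρ) (B := coeff ρ) (MonoidHom.id _)
    (Rep.ofHom (f.intertwiningMap_of_isIntertwiningMap (leftRep ρ) (leftRep ρ)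
      fun _ m => hf _ m)) 1).hom

theorem coeffH1_classOf (f : M →ₗ[ℤ] M) (hf : ∀ δ m, f (ρ δ m) = ρ δ (f m))
    (c : groupCohomology.cocycles₁ (coeff ρ)) :
    ∃ c' : groupCohomology.cocycles₁ (coeff ρ), (∀ γ, c' γ = f (c γ)) ∧
      coeffH1 f hf (classOf ρ c) = classOf ρ c' :=
  ⟨_, fun _ => rfl, groupCohomology.H1π_comp_map_apply (A := coeff ρ) (B := coeff ρ)
    (MonoidHom.id _) (Rep.ofHom (f.intertwiningMap_of_isIntertwiningMap (leftRep ρ) (leftRep ρ)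
      fun _ m => hf _ m)) c⟩

/-- The endomorphism of `H¹_par(Γ₀(N), M)` induced by an endomorphism of `M` that commutes with
`Σ₀(N)`. -/
def coeffPar (f : M →ₗ[ℤ] M) (hf : ∀ δ m, f (ρ δ m) = ρ δ (f m)) : H1par ρ →ₗ[ℤ] H1par ρ :=
  (coeffH1 f hf).restrict fun x hx => by
    obtain ⟨c, rfl⟩ := classOf_surjective ρ x
    obtain ⟨c', hc', h⟩ := coeffH1_classOf f hf c
    rw [h]
    refine (classOf_mem_H1par_iff ρ _).2 fun r => ?_
    obtain ⟨v, hv⟩ := (classOf_mem_H1par_iff ρ _).1 hx r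
    refine ⟨f v, fun γ hγ => ?_⟩
    rw [hc', hv γ hγ, map_sub, leftRep_apply, leftRep_apply, hf]

variable (ρ)

/-! ### Hecke operators -/

/-- The double coset `Γ₀(N) α Γ₀(N)`. -/
def doubleCoset (α : Sigma0 N) : Set (Sigma0 N) :=
  {δ | ∃ γ γ' : Gamma0 N, δ = gammaToSigma N γ * α * gammaToSigma N γ'}

/-- Two elements of `Γ₀(N) α Γ₀(N)` are equivalent if they lie in the same coset `Γ₀(N) δ`. -/
def cosetSetoid (α : Sigma0 N) : Setoid (doubleCoset α) where
  r δ δ' := ∃ γ : Gamma0 N, δ'.1 = gammaToSigma N γ * δ.1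
  iseqv :=
    { refl := fun δ => ⟨1, by simp⟩
      symm := by
        rintro δ δ' ⟨γ, h⟩
        exact ⟨γ⁻¹, by rw [h, ← mul_assoc, ← map_mul, inv_mul_cancel, map_one, one_mul]⟩
      trans := by
        rintro δ δ' δ'' ⟨γ, h⟩ ⟨γ', h'⟩
        exact ⟨γ' * γ, by rw [h', h, ← mul_assoc, ← map_mul]⟩ }

/-- The set `Γ₀(N) \ Γ₀(N) α Γ₀(N)` of cosets `Γ₀(N) δ`. -/
abbrev Cosets (α : Sigma0 N) : Type := Quotient (cosetSetoid α)

/-- A chosen representative `δ_q` of the coset `q`. -/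
def repr {α : Sigma0 N} (q : Cosets α) : Sigma0 N := q.out.1

theorem sigma_mul_right_cancel {a b δ : Sigma0 N} (h : a * δ = b * δ) : a = b := by
  apply Subtype.ext
  have h' : (a : Matrix (Fin 2) (Fin 2) ℤ) * δ = b * δ := congrArg Subtype.val h
  have h2 := congrArg (· * (δ : Matrix (Fin 2) (Fin 2) ℤ).adjugate) h'
  simp only [Matrix.mul_assoc, Matrix.mul_adjugate, Matrix.mul_smul, Matrix.mul_one] at h2
  exact smul_right_injective _ (det_ne_zero_of_sigma δ) h2

theorem gammaToSigma_injective : Function.Injective (gammaToSigma N) := fun γ γ' h => by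
  have h' := congrArg Subtype.val h
  exact Subtype.ext (Subtype.ext h')

theorem det_of_mem_doubleCoset {α δ : Sigma0 N} (h : δ ∈ doubleCoset α) :
    (δ : Matrix (Fin 2) (Fin 2) ℤ).det = (α : Matrix (Fin 2) (Fin 2) ℤ).det := by
  obtain ⟨γ, γ', rfl⟩ := h
  simp [gammaToSigma]

/-- Elements of `Σ₀(N)` of the same determinant `m` that are congruent modulo `m N` lie in the
same coset. -/
theorem exists_gamma_of_congr {δ δ' : Sigma0 N} (X : Matrix (Fin 2) (Fin 2) ℤ)
    (hdet : (δ' : Matrix (Fin 2) (Fin 2) ℤ).det = (δ : Matrix (Fin 2) (Fin 2) ℤ).det)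
    (h : (δ' : Matrix (Fin 2) (Fin 2) ℤ) =
      δ + ((δ : Matrix (Fin 2) (Fin 2) ℤ).det * N) • X) :
    ∃ γ : Gamma0 N, δ' = gammaToSigma N γ * δ := by
  set d := (δ : Matrix (Fin 2) (Fin 2) ℤ) with hd
  set g : Matrix (Fin 2) (Fin 2) ℤ := 1 + (N : ℤ) • (X * d.adjugate) with hg
  have hmul : (δ' : Matrix (Fin 2) (Fin 2) ℤ) = g * d := by
    rw [h, hg, add_mul, one_mul, smul_mul_assoc, Matrix.mul_assoc, adjugate_mul,
      Matrix.mul_smul, Matrix.mul_one, smul_smul, mul_comm]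
  have hdet1 : g.det = 1 := by
    have h1 := hdet
    rw [hmul, det_mul] at h1
    exact mul_right_cancel₀ (det_ne_zero_of_sigma δ) (h1.trans (one_mul _).symm)
  refine ⟨⟨(⟨g, hdet1⟩ : SL(2, ℤ)), Gamma0_mem.2 ?_⟩, Subtype.ext hmul⟩
  change (((1 : Matrix (Fin 2) (Fin 2) ℤ) 1 0 + (N : ℤ) * (X * d.adjugate) 1 0 : ℤ) : ZMod N) = 0
  simp

instance finite_cosets [NeZero N] (α : Sigma0 N) : Finite (Cosets α) := by
  set m := (α : Matrix (Fin 2) (Fin 2) ℤ).det with hm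
  have hm0 : m ≠ 0 := det_ne_zero_of_sigma α
  have hk : NeZero (m.natAbs * N) :=
    ⟨mul_ne_zero (Int.natAbs_ne_zero.2 hm0) (NeZero.ne N)⟩
  let F : Cosets α → Fin 2 → Fin 2 → ZMod (m.natAbs * N) :=
    fun q i j => (((repr q : Matrix (Fin 2) (Fin 2) ℤ) i j : ℤ) : ZMod (m.natAbs * N))
  refine Finite.of_injective F fun q q' hqq => ?_
  rw [← Quotient.out_eq q, ← Quotient.out_eq q']
  apply Quotient.sound
  have hdvd : ∀ i j, m * N ∣ (repr q' : Matrix (Fin 2) (Fin 2) ℤ) i j -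
      (repr q : Matrix (Fin 2) (Fin 2) ℤ) i j := fun i j => by
    have h1 := (ZMod.intCast_eq_intCast_iff_dvd_sub _ _ _).1 (congrFun (congrFun hqq i) j)
    refine dvd_trans ?_ h1
    push_cast
    exact mul_dvd_mul_right (self_dvd_abs m) _
  choose X hX using hdvd
  have h1 : (repr q : Matrix (Fin 2) (Fin 2) ℤ).det = m := det_of_mem_doubleCoset q.out.2
  have h2 : (repr q' : Matrix (Fin 2) (Fin 2) ℤ).det = m := det_of_mem_doubleCoset q'.out.2
  refine exists_gamma_of_congr (Matrix.of X) (h2.trans h1.symm) ?_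
  change (repr q' : Matrix (Fin 2) (Fin 2) ℤ) =
    (repr q : Matrix (Fin 2) (Fin 2) ℤ) + _
  change _ = (repr q : Matrix (Fin 2) (Fin 2) ℤ) +
    ((repr q : Matrix (Fin 2) (Fin 2) ℤ).det * N) • Matrix.of X
  rw [h1]
  ext i j
  have := hX i j
  simp only [Matrix.add_apply, Matrix.smul_apply, Matrix.of_apply, smul_eq_mul]
  linarith

instance fintype_cosets [NeZero N] (α : Sigma0 N) : Fintype (Cosets α) := Fintype.ofFinite _

/-- Right translation of cosets, `Γ₀(N) δ ↦ Γ₀(N) δ γ`. -/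
def translate {α : Sigma0 N} (γ : Gamma0 N) : Cosets α → Cosets α :=
  Quotient.map (fun δ => ⟨δ.1 * gammaToSigma N γ, by
    obtain ⟨a, b, h⟩ := δ.2
    exact ⟨a, b * γ, by rw [h, map_mul, mul_assoc _ _ (gammaToSigma N γ)]⟩⟩) (by
    rintro δ δ' ⟨a, h⟩
    exact ⟨a, by change δ'.1 * _ = _ * (δ.1 * _); rw [h, mul_assoc]⟩)

theorem translate_mul {α : Sigma0 N} (γ γ' : Gamma0 N) (q : Cosets α) :
    translate (γ * γ') q = translate γ' (translate γ q) := by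
  induction q using Quotient.inductionOn with
  | h δ =>
    apply congrArg (Quotient.mk _)
    apply Subtype.ext
    change δ.1 * gammaToSigma N (γ * γ') = δ.1 * gammaToSigma N γ * gammaToSigma N γ'
    rw [map_mul, mul_assoc]

theorem translate_one {α : Sigma0 N} (q : Cosets α) : translate 1 q = q := by
  induction q using Quotient.inductionOn with
  | h δ =>
    apply congrArg (Quotient.mk _)
    apply Subtype.ext
    change δ.1 * gammaToSigma N 1 = δ.1
    rw [map_one, mul_one]

/-- Right translation by `γ` is a bijection. -/
def translateEquiv (α : Sigma0 N) (γ : Gamma0 N) : Cosets α ≃ Cosets α where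
  toFun := translate γ
  invFun := translate γ⁻¹
  left_inv q := by rw [← translate_mul, mul_inv_cancel, translate_one]
  right_inv q := by rw [← translate_mul, inv_mul_cancel, translate_one]

theorem exists_correction {α : Sigma0 N} (γ : Gamma0 N) (q : Cosets α) :
    ∃ γ' : Gamma0 N, repr q * gammaToSigma N γ = gammaToSigma N γ' * repr (translate γ q) := by
  have h : translate γ q = translate γ (Quotient.mk _ q.out) := by rw [Quotient.out_eq]
  obtain ⟨a, ha⟩ := Quotient.exact ((Quotient.out_eq (translate γ q)).trans h)
  exact ⟨a, ha⟩

/-- The element `γ_q ∈ Γ₀(N)` with `δ_q γ = γ_q δ_{qγ}`. -/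
def correction {α : Sigma0 N} (γ : Gamma0 N) (q : Cosets α) : Gamma0 N :=
  (exists_correction γ q).choose

theorem correction_spec {α : Sigma0 N} (γ : Gamma0 N) (q : Cosets α) :
    repr q * gammaToSigma N γ = gammaToSigma N (correction γ q) * repr (translate γ q) :=
  (exists_correction γ q).choose_spec

theorem correction_mul {α : Sigma0 N} (γ γ' : Gamma0 N) (q : Cosets α) :
    correction (γ * γ') q = correction γ q * correction γ' (translate γ q) := by
  apply gammaToSigma_injective
  apply sigma_mul_right_cancel (δ := repr (translate (γ * γ') q))
  rw [← correction_spec, map_mul, ← mul_assoc, correction_spec γ q, mul_assoc, correction_spec,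
    ← mul_assoc, ← map_mul, translate_mul]

theorem act_correction {α : Sigma0 N} (γ : Gamma0 N) (q : Cosets α) (m : M) :
    ρ (op (repr q)) (leftRep ρ (correction γ q) m) =
      leftRep ρ γ (ρ (op (repr (translate γ q))) m) := by
  rw [leftRep_apply, leftRep_apply, act_act, act_act]
  congr 3
  have h := correction_spec γ q
  calc gammaToSigma N (correction γ q)⁻¹ * repr q
      = gammaToSigma N (correction γ q)⁻¹ * (repr q * gammaToSigma N γ) *
          gammaToSigma N γ⁻¹ := by
        rw [mul_assoc, mul_assoc, ← map_mul, mul_inv_cancel, map_one, mul_one]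
    _ = repr (translate γ q) * gammaToSigma N γ⁻¹ := by
        rw [h, ← mul_assoc, ← map_mul, inv_mul_cancel, map_one, one_mul]

theorem cocycle_mul (c : groupCohomology.cocycles₁ (coeff ρ)) (γ γ' : Gamma0 N) :
    c (γ * γ') = leftRep ρ γ (c γ') + c γ :=
  (groupCohomology.mem_cocycles₁_iff _).1 c.2 γ γ'

/-- The Hecke operator of the double coset `Γ₀(N) α Γ₀(N)` on `1`-cocycles:
`(c|T)(γ) = ∑_q c(γ_q)|δ_q`, where `δ_q γ = γ_q δ_{qγ}`. -/
def heckeCocycle [NeZero N] (α : Sigma0 N) :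
    groupCohomology.cocycles₁ (coeff ρ) →ₗ[ℤ] groupCohomology.cocycles₁ (coeff ρ) where
  toFun c := ⟨fun γ => ∑ q : Cosets α, ρ (op (repr q)) (c (correction γ q)),
    (groupCohomology.mem_cocycles₁_iff _).2 fun γ γ' => by
      change _ = leftRep ρ γ _ + _
      rw [map_sum, ← (translateEquiv α γ).sum_comp (fun q => leftRep ρ γ _),
        ← Finset.sum_add_distrib]
      refine Finset.sum_congr rfl fun q _ => ?_
      rw [correction_mul, cocycle_mul, map_add, act_correction]
      rfl⟩
  map_add' c c' := by
    apply Subtype.ext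
    funext γ
    change ∑ q : Cosets α, ρ (op (repr q)) (c (correction γ q) + c' (correction γ q)) =
      ∑ q : Cosets α, _ + ∑ q : Cosets α, _
    simp only [map_add, Finset.sum_add_distrib]
  map_smul' a c := by
    apply Subtype.ext
    funext γ
    change ∑ q : Cosets α, ρ (op (repr q)) (a • c (correction γ q)) = a • ∑ q : Cosets α, _
    simp only [map_smul, Finset.smul_sum]

theorem heckeCocycle_apply [NeZero N] (α : Sigma0 N)
    (c : groupCohomology.cocycles₁ (coeff ρ)) (γ : Gamma0 N) :
    heckeCocycle ρ α c γ = ∑ q : Cosets α, ρ (op (repr q)) (c (correction γ q)) := rfl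

theorem ker_classOf_le [NeZero N] (α : Sigma0 N) :
    LinearMap.ker (classOf ρ) ≤ LinearMap.ker (classOf ρ ∘ₗ heckeCocycle ρ α) := by
  intro c hc
  obtain ⟨v, hv⟩ := (classOf_eq_zero_iff ρ c).1 hc
  refine (classOf_eq_zero_iff ρ _).2 ⟨∑ q : Cosets α, ρ (op (repr q)) v, fun γ => ?_⟩
  rw [heckeCocycle_apply, map_sum,
    ← (translateEquiv α γ).sum_comp (fun q => leftRep ρ γ _), ← Finset.sum_sub_distrib]
  refine Finset.sum_congr rfl fun q _ => ?_
  rw [hv, map_sub, act_correction]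
  rfl

/-- The Hecke operator of the double coset `Γ₀(N) α Γ₀(N)` on `H¹(Γ₀(N), M)`, induced by its
action on cocycles. -/
def heckeH1 [NeZero N] (α : Sigma0 N) : H1 ρ →ₗ[ℤ] H1 ρ :=
  (LinearMap.ker (classOf ρ)).liftQ (classOf ρ ∘ₗ heckeCocycle ρ α) (ker_classOf_le ρ α) ∘ₗ
    ((classOf ρ).quotKerEquivOfSurjective (classOf_surjective ρ)).symm.toLinearMap

theorem heckeH1_classOf [NeZero N] (α : Sigma0 N) (c : groupCohomology.cocycles₁ (coeff ρ)) :
    heckeH1 ρ α (classOf ρ c) = classOf ρ (heckeCocycle ρ α c) := by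
  have h : ((classOf ρ).quotKerEquivOfSurjective (classOf_surjective ρ)).symm (classOf ρ c) =
      Submodule.Quotient.mk c := by
    rw [LinearEquiv.symm_apply_eq]
    rfl
  rw [heckeH1, LinearMap.comp_apply, LinearEquiv.coe_coe, h]
  rfl

/-- A class is parabolic if and only if it becomes a coboundary for the functions `ℙ¹(ℚ) → M`. -/
theorem classOf_mem_H1par_iff_exists (c : groupCohomology.cocycles₁ (coeff ρ)) :
    classOf ρ c ∈ H1par ρ ↔ ∃ f : OnePoint ℚ → M, ∀ (γ : Gamma0 N) (r : OnePoint ℚ),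
      f (toGL N (gammaToSigma N γ) • r) = leftRep ρ γ (f r) - c γ := by
  rw [classOf_mem_H1par_iff]
  constructor
  · intro h
    choose v hv using h
    let _ : MulAction (Gamma0 N) (OnePoint ℚ) :=
      MulAction.compHom _ ((toGL N).comp (gammaToSigma N))
    let s : OnePoint ℚ → OnePoint ℚ := fun r =>
      (Quotient.mk (MulAction.orbitRel (Gamma0 N) (OnePoint ℚ)) r).out
    have hs : ∀ r, ∃ γ : Gamma0 N, γ • s r = r := fun r => by
      have h1 : (MulAction.orbitRel (Gamma0 N) (OnePoint ℚ)) r (s r) :=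
        (MulAction.orbitRel (Gamma0 N) (OnePoint ℚ)).symm
          (Quotient.mk_out (s := MulAction.orbitRel (Gamma0 N) (OnePoint ℚ)) r)
      exact h1
    have hs' : ∀ (γ : Gamma0 N) r, s (γ • r) = s r := fun γ r => by
      have : Quotient.mk (MulAction.orbitRel (Gamma0 N) (OnePoint ℚ)) (γ • r) =
          Quotient.mk (MulAction.orbitRel (Gamma0 N) (OnePoint ℚ)) r :=
        Quotient.sound ⟨γ, rfl⟩
      simp only [s, this]
    choose t ht using hs
    refine ⟨fun r => leftRep ρ (t r) (v (s r)) - c (t r), fun γ r => ?_⟩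
    change leftRep ρ (t (γ • r)) (v (s (γ • r))) - c (t (γ • r)) = _
    rw [hs']
    set a := t (γ • r) with ha
    have h1 : a • s r = γ • t r • s r := by
      rw [ht r, ← hs' γ r, ht]
    set b := γ * t r with hb
    have hmem : b⁻¹ * a ∈ cuspStabilizer N (s r) := by
      change (b⁻¹ * a) • s r = s r
      rw [mul_smul, h1, ← mul_smul γ, ← hb, ← mul_smul, inv_mul_cancel, one_smul]
    have h2 := hv (s r) _ hmem
    have h3 : c a = leftRep ρ a (v (s r)) - leftRep ρ b (v (s r)) + c b := by
      have h4 := cocycle_mul ρ c b (b⁻¹ * a)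
      rw [h2, map_sub, mul_inv_cancel_left] at h4
      rw [h4, ← Module.End.mul_apply, ← map_mul, mul_inv_cancel_left]
    have h5 : c b = leftRep ρ γ (c (t r)) + c γ := cocycle_mul ρ c γ (t r)
    have h6 : leftRep ρ b (v (s r)) = leftRep ρ γ (leftRep ρ (t r) (v (s r))) := by
      rw [hb, map_mul]; rfl
    rw [h3, h5, h6, map_sub]
    abel
  · rintro ⟨f, hf⟩ r
    refine ⟨f r, fun γ hγ => ?_⟩
    have h := hf γ r
    rw [(mem_cuspStabilizer r γ).1 hγ] at h
    rw [eq_sub_iff_add_eq, add_comm]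
    exact (eq_sub_iff_add_eq.1 h)

/-- The Hecke operator of the double coset `Γ₀(N) α Γ₀(N)` on `H¹_par(Γ₀(N), M)`. -/
def heckePar [NeZero N] (α : Sigma0 N) : H1par ρ →ₗ[ℤ] H1par ρ :=
  (heckeH1 ρ α).restrict fun x hx => by
    obtain ⟨c, rfl⟩ := classOf_surjective ρ x
    rw [heckeH1_classOf]
    obtain ⟨f, hf⟩ := (classOf_mem_H1par_iff_exists ρ c).1 hx
    refine (classOf_mem_H1par_iff_exists ρ _).2
      ⟨fun r => ∑ q : Cosets α, ρ (op (repr q)) (f (toGL N (repr q) • r)), fun γ r => ?_⟩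
    rw [heckeCocycle_apply, map_sum,
      ← (translateEquiv α γ).sum_comp (fun q => leftRep ρ γ _), ← Finset.sum_sub_distrib]
    refine Finset.sum_congr rfl fun q _ => ?_
    change _ = leftRep ρ γ (ρ (op (repr (translate γ q))) _) - _
    rw [← mul_smul, ← map_mul, correction_spec, map_mul, mul_smul, hf, map_sub, act_correction]
    rfl

/-- The matrix `diag(1, m)`. -/
def diagOne (N m : ℕ) (hm : 0 < m) : Sigma0 N :=
  ⟨!![1, 0; 0, (m : ℤ)], by simpa [det_fin_two] using hm, by simp [isCoprime_one_left], by simp⟩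

/-- The Hecke operator `T_m` on `H¹_par(Γ₀(N), M)`. -/
def heckeT [NeZero N] (m : ℕ) (hm : 0 < m) : H1par ρ →ₗ[ℤ] H1par ρ :=
  heckePar ρ (diagOne N m hm)

end Module

/-! ### The second Milnor `K`-group modulo `2`-torsion -/

section Milnor

variable (R S T : Type) [CommRing R] [CommRing S] [CommRing T]

/-- The subgroup of `Rˣ ⊗ Rˣ` generated by the `a ⊗ b` with `a + b ∈ {0, 1}`. -/
def steinbergRel : Submodule ℤ (Additive Rˣ ⊗[ℤ] Additive Rˣ) :=
  Submodule.span ℤ {t | ∃ a b : Rˣ, ((a : R) + b = 0 ∨ (a : R) + b = 1) ∧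
    t = Additive.ofMul a ⊗ₜ[ℤ] Additive.ofMul b}

/-- The second Milnor `K`-group `K₂(R)`, written additively. -/
abbrev K2 : Type := (Additive Rˣ ⊗[ℤ] Additive Rˣ) ⧸ steinbergRel R

/-- `K₂(R)` modulo `2`-torsion. -/
abbrev K2Tilde : Type := K2 R ⧸ Submodule.torsionBy ℤ (K2 R) 2

variable {R S T}

/-- The Steinberg symbol `{a, b}`, in `K₂(R)` modulo `2`-torsion. -/
def steinberg (a b : Rˣ) : K2Tilde R :=
  Submodule.Quotient.mk (Submodule.Quotient.mk (Additive.ofMul a ⊗ₜ[ℤ] Additive.ofMul b))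

/-- The map on unit groups induced by a ring homomorphism. -/
def unitsHom (f : R →+* S) : Additive Rˣ →ₗ[ℤ] Additive Sˣ :=
  (MonoidHom.toAdditive (Units.map (f : R →* S))).toIntLinearMap

/-- The map `K₂(R) → K₂(S)` induced by a ring homomorphism. -/
def K2.map (f : R →+* S) : K2 R →ₗ[ℤ] K2 S :=
  (steinbergRel R).mapQ (steinbergRel S) (TensorProduct.map (unitsHom f) (unitsHom f)) (by
    refine Submodule.span_le.2 ?_
    rintro _ ⟨a, b, h, rfl⟩
    refine Submodule.subset_span ⟨Units.map (f : R →* S) a, Units.map (f : R →* S) b, ?_, rfl⟩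
    refine h.imp (fun h => ?_) (fun h => ?_)
    · simpa using congrArg f h
    · simpa using congrArg f h)

/-- The map on `K₂` modulo `2`-torsion induced by a ring homomorphism. -/
def K2Tilde.map (f : R →+* S) : K2Tilde R →ₗ[ℤ] K2Tilde S :=
  (Submodule.torsionBy ℤ (K2 R) 2).mapQ (Submodule.torsionBy ℤ (K2 S) 2) (K2.map f) (by
    intro x hx
    rw [Submodule.mem_torsionBy_iff] at hx
    rw [Submodule.mem_comap, Submodule.mem_torsionBy_iff, ← map_smul, hx, map_zero])

theorem K2Tilde.map_steinberg (f : R →+* S) (a b : Rˣ) :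
    K2Tilde.map f (steinberg a b) =
      steinberg (Units.map (f : R →* S) a) (Units.map (f : R →* S) b) := rfl

theorem K2Tilde.hom_ext {M : Type} [AddCommGroup M] {f g : K2Tilde R →ₗ[ℤ] M}
    (h : ∀ a b : Rˣ, f (steinberg a b) = g (steinberg a b)) : f = g := by
  refine Submodule.linearMap_qext _ (Submodule.linearMap_qext _ (TensorProduct.ext' ?_))
  exact fun a b => h a.toMul b.toMul

theorem K2Tilde.map_id : K2Tilde.map (RingHom.id R) = LinearMap.id :=
  K2Tilde.hom_ext fun _ _ => rfl

theorem K2Tilde.map_comp (g : S →+* T) (f : R →+* S) :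
    K2Tilde.map (g.comp f) = K2Tilde.map g ∘ₗ K2Tilde.map f :=
  K2Tilde.hom_ext fun _ _ => rfl

end Milnor

/-! ### The ring `ℤ[μ_{pⁿ}, 1/p]` and the action of the Galois group -/

section Cyclotomic

variable (p n : ℕ) (K : Type) [Field K]

/-- The subring `ℤ[μ_{pⁿ}, 1/p]` of `K`. -/
abbrev pIntegers : Subalgebra ℤ K :=
  Algebra.adjoin ℤ ({z : K | z ^ p ^ n = 1} ∪ {(p : K)⁻¹})

variable [NumberField K]

/-- The restriction of an automorphism of `K` to `ℤ[μ_{pⁿ}, 1/p]`. -/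
def galRing (σ : Gal(K/ℚ)) : pIntegers p n K →+* pIntegers p n K :=
  ((σ : K →+* K).comp (pIntegers p n K).val.toRingHom).codRestrict (pIntegers p n K) (by
    rintro ⟨x, hx⟩
    change σ x ∈ pIntegers p n K
    have h : pIntegers p n K ≤ (pIntegers p n K).comap (σ : K →+* K).toIntAlgHom := by
      refine Algebra.adjoin_le ?_
      rintro z (hz | rfl)
      · refine Algebra.subset_adjoin (Or.inl ?_)
        change σ z ^ p ^ n = 1
        rw [← map_pow, show z ^ p ^ n = 1 from hz, map_one]
      · refine Algebra.subset_adjoin (Or.inr ?_)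
        change σ (p : K)⁻¹ = (p : K)⁻¹
        rw [map_inv₀, map_natCast]
    exact h hx)

/-- The action of the Galois group on `K₂(ℤ[μ_{pⁿ}, 1/p])` modulo `2`-torsion. -/
def galRep : Representation ℤ Gal(K/ℚ) (K2Tilde (pIntegers p n K)) where
  toFun σ := K2Tilde.map (galRing p n K σ)
  map_one' := K2Tilde.map_id
  map_mul' σ τ := K2Tilde.map_comp (galRing p n K σ) (galRing p n K τ)

/-- The class modulo `N` of the upper left entry of a matrix in `Σ₀(N)`. -/
def upperLeft (N : ℕ) : Sigma0 N →* (ZMod N)ˣ where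
  toFun δ := ((ZMod.coe_int_isUnit_iff_isCoprime _ _).2 δ.2.2.1.symm).unit
  map_one' := by ext; simp
  map_mul' δ δ' := by
    ext
    have h : (((δ' : Matrix (Fin 2) (Fin 2) ℤ) 1 0 : ℤ) : ZMod N) = 0 :=
      (ZMod.intCast_zmod_eq_zero_iff_dvd _ _).2 δ'.2.2.2
    simp [Matrix.mul_apply, Fin.sum_univ_two, h]

variable [Fact p.Prime]

/-! ### The Manin symbol -/

section Manin

variable {p n K}

theorem isUnit_one_sub {ζ : pIntegers p n K} (hζ : IsPrimitiveRoot ζ (p ^ n))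
    {x : ZMod (p ^ n)} (hx : x ≠ 0) : IsUnit (1 - ζ ^ x.val) := by
  have hp : (p : K) ≠ 0 := Nat.cast_ne_zero.2 (Fact.out : p.Prime).ne_zero
  have h1 : ζ ^ x.val ≠ 1 := fun h => by
    have h2 := Nat.eq_zero_of_dvd_of_lt (hζ.dvd_of_pow_eq_one _ h) (ZMod.val_lt x)
    exact hx ((ZMod.val_eq_zero x).1 h2)
  have h2 : ∑ i ∈ Finset.range (p ^ n), (ζ ^ x.val) ^ i = 0 := by
    have h3 := geom_sum_mul (ζ ^ x.val) (p ^ n)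
    rw [← pow_mul, mul_comm x.val, pow_mul, hζ.pow_eq_one, one_pow, sub_self] at h3
    exact (mul_eq_zero.1 h3).resolve_right (sub_ne_zero.2 h1)
  have h3 := Polynomial.sub_dvd_eval_sub (1 : pIntegers p n K) (ζ ^ x.val)
    (∑ i ∈ Finset.range (p ^ n), Polynomial.X ^ i)
  simp only [Polynomial.eval_finsetSum, Polynomial.eval_pow, Polynomial.eval_X, one_pow, h2,
    sub_zero, Finset.sum_const, Finset.card_range, nsmul_eq_mul, mul_one] at h3
  refine isUnit_of_dvd_unit h3 ?_
  rw [Nat.cast_pow]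
  refine IsUnit.pow _ (IsUnit.of_mul_eq_one
    ⟨(p : K)⁻¹, Algebra.subset_adjoin (Or.inr rfl)⟩ (Subtype.ext ?_))
  change (p : K) * (p : K)⁻¹ = 1
  exact mul_inv_cancel₀ hp

/-- The unit `1 - ζ ^ x` of `ℤ[μ_{pⁿ}, 1/p]`, for a nonzero `x ∈ ℤ/pⁿ`. -/
def oneSub {ζ : pIntegers p n K} (hζ : IsPrimitiveRoot ζ (p ^ n))
    (x : ZMod (p ^ n)) (hx : x ≠ 0) : (pIntegers p n K)ˣ :=
  (isUnit_one_sub hζ hx).unit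

open Classical in
/-- The Manin symbol `e_n(x, y)`: the Steinberg symbol `{1 - ζ ^ x, 1 - ζ ^ y}` if `x, y ≠ 0`, and
`0` otherwise. -/
def maninSymbol {ζ : pIntegers p n K} (hζ : IsPrimitiveRoot ζ (p ^ n))
    (x y : ZMod (p ^ n)) : K2Tilde (pIntegers p n K) :=
  if h : x ≠ 0 ∧ y ≠ 0 then steinberg (oneSub hζ x h.1) (oneSub hζ y h.2) else 0

end Manin

variable [IsCyclotomicExtension {p ^ n} ℚ K]

/-- The automorphism `σ_a` of `K = ℚ(μ_{pⁿ})`, with `σ_a(ζ) = ζ ^ a` for all `ζ ∈ μ_{pⁿ}`. -/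
def galOf : (ZMod (p ^ n))ˣ →* Gal(K/ℚ) :=
  (IsCyclotomicExtension.Rat.galEquivZMod (p ^ n) K).symm.toMonoidHom

theorem galOf_apply (a : (ZMod (p ^ n))ˣ) {x : K} (hx : x ^ p ^ n = 1) :
    galOf p n K a x = x ^ (a : ZMod (p ^ n)).val := by
  rw [IsCyclotomicExtension.Rat.galEquivZMod_apply_of_pow_eq (p ^ n) K _ hx, galOf,
    MulEquiv.toMonoidHom_eq_coe, MonoidHom.coe_coe, MulEquiv.apply_symm_apply]

/-- The right action of `Σ₀(pⁿ)` on `K₂(ℤ[μ_{pⁿ}, 1/p])` modulo `2`-torsion through the Artin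
nebentype character: `m|δ = σ_a(m)`, with `a` the upper left entry of `δ`. -/
def artinRep : Representation ℤ (Sigma0 (p ^ n))ᵐᵒᵖ (K2Tilde (pIntegers p n K)) :=
  (galRep p n K).comp
    ((galOf p n K).comp ((upperLeft (p ^ n)).fromOpposite fun _ _ => Commute.all _ _))

theorem artinRep_apply (δ : Sigma0 (p ^ n)) (m : K2Tilde (pIntegers p n K)) :
    artinRep p n K (op δ) m = galRep p n K (galOf p n K (upperLeft (p ^ n) δ)) m := rfl

theorem galRep_comm (a b : (ZMod (p ^ n))ˣ) (m : K2Tilde (pIntegers p n K)) :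
    galRep p n K (galOf p n K a) (galRep p n K (galOf p n K b) m) =
      galRep p n K (galOf p n K b) (galRep p n K (galOf p n K a) m) := by
  have h : ∀ s t : Gal(K/ℚ), galRep p n K s (galRep p n K t m) = galRep p n K (s * t) m :=
    fun s t => by rw [map_mul]; rfl
  rw [h, h, ← map_mul, ← map_mul, mul_comm a b]

theorem galRep_artinRep (s : Gal(K/ℚ)) (δ : (Sigma0 (p ^ n))ᵐᵒᵖ)
    (m : K2Tilde (pIntegers p n K)) :
    galRep p n K s (artinRep p n K δ m) = artinRep p n K δ (galRep p n K s m) := by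
  obtain ⟨a, rfl⟩ := (IsCyclotomicExtension.Rat.galEquivZMod (p ^ n) K).symm.surjective s
  exact galRep_comm p n K a (upperLeft (p ^ n) δ.unop) m

/-- The action of the Galois group on `H¹_par(Γ₀(pⁿ), K₂(ℤ[μ_{pⁿ}, 1/p]) / 2-torsion)` through
the coefficients. -/
def galPar (s : Gal(K/ℚ)) : H1par (artinRep p n K) →ₗ[ℤ] H1par (artinRep p n K) :=
  coeffPar (galRep p n K s) (galRep_artinRep p n K s)

/-! ### The modular symbol -/

variable {p n K}

/-- The modular symbol `φ` corresponds to the Manin symbol `e_n`, that is, `e_n(x) = φ(γ(∞ - 0))`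
for all `x = (0, 1)γ` with `γ ∈ SL₂(ℤ)`. -/
def IsSteinbergSymb {ζ : pIntegers p n K} (hζ : IsPrimitiveRoot ζ (p ^ n))
    (φ : Symb (artinRep p n K)) : Prop :=
  ∀ γ : SL(2, ℤ),
    φ.1 (actDiv (SpecialLinearGroup.mapGL ℚ γ) (divSub OnePoint.infty ((0 : ℚ) : OnePoint ℚ))) =
      maninSymbol hζ (γ 1 0 : ℤ) (γ 1 1 : ℤ)

/-- A prime `q ≠ p`, as a unit modulo `pⁿ`. -/
def primeUnit (p n : ℕ) [Fact p.Prime] (q : ℕ) (hq : q.Prime) (h : p ≠ q) : (ZMod (p ^ n))ˣ :=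
  ZMod.unitOfCoprime q
    (Nat.Coprime.pow_right n ((Nat.coprime_primes hq Fact.out).2 h.symm))

end Cyclotomic

end SteinbergSymbol

end

noncomputable section

open Matrix CongruenceSubgroup MulOpposite
open scoped MatrixGroups TensorProduct

namespace SteinbergSymbol

variable {N : ℕ} {M : Type} [AddCommGroup M]

/-! ### Unimodular symbols generate `Δ₀` -/

/-! Write `e(x, y)` for the Manin symbol `{1 - ζ^x, 1 - ζ^y}`. Unimodular symbols generate `Δ₀`
(`span_unimodular`), which gives uniqueness.

For existence, the Manin relations are integrated explicitly. The Euclidean algorithm yields `G`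
with `G(x, y) - G(y, -x) = e(x, y)` on coprime pairs. `G` is invariant under `±T`, so it is a
function `F` of the cusp, and the symbol is `(r) - (s) ↦ F(r) - F(s)` (`euclidSumInt_sub`,
`exists_hom_of_isManin`).

The relations for `e` rest on one principle, `steinberg_three_term`. Modulo 2-torsion, `-1` has
trivial symbols, and `ζ` has trivial symbol with every `1 - ζ^x` (`oneSub_mem_nullUnits`). So `c =
±ζ^i a ± ζ^j b` forces `{a, b} = {a, c} + {c, b}` for units `a, b, c` built from these. Applied to
`1 - ζ^(x+y) = (1 - ζ^x) + ζ^x (1 - ζ^y)`, this is the three-term Manin relation.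

For the Hecke operators, right multiplication by `γ` matches the cosets with Hermite forms of
determinant `m` (`exists_cosets_equiv`). When all residues modulo `m` are `0` or `±1`, as for `m =
2, 3`, each term is at most two unimodular symbols, and `heckeHom_unimodular` expresses `φ|T_m`
through `e`. With `s = (1 - ζ^(mx)) / (1 - ζ^x)` and `t` the same for `y`, the principle applied to
`s`, `t` and a product of cyclotomic units gives the eigenvalue relation for `x, y ≠ 0`
(`maninSymbol_T2`, `maninSymbol_T3`).

If `x` or `y` is zero, an error term survives. It is the boundary of a function supported on the
`Γ₀`-orbit of `∞` and equivariant there, hence a coboundary, so the relation holds for cohomology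
classes (`heckeT_symbToPar`). -/

theorem SL_coe_mul (γ γ' : SL(2, ℤ)) : ((γ * γ' : SL(2, ℤ)) : Matrix (Fin 2) (Fin 2) ℤ) =
    (γ : Matrix (Fin 2) (Fin 2) ℤ) * (γ' : Matrix (Fin 2) (Fin 2) ℤ) := rfl

theorem SL_coe_one : ((1 : SL(2, ℤ)) : Matrix (Fin 2) (Fin 2) ℤ) = 1 := rfl

theorem SL_mul_apply (γ γ' : SL(2, ℤ)) (i j : Fin 2) :
    (γ * γ') i j = γ i 0 * γ' 0 j + γ i 1 * γ' 1 j := by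
  change (γ.1 * γ'.1) i j = _
  rw [Matrix.mul_apply, Fin.sum_univ_two]

theorem mapGL_apply (γ : SL(2, ℤ)) (i j : Fin 2) :
    SpecialLinearGroup.mapGL ℚ γ i j = (γ i j : ℚ) := rfl

theorem actDiv_mul (g h : GL (Fin 2) ℚ) (D : Div0) :
    actDiv (g * h) D = actDiv g (actDiv h D) := by
  apply Subtype.ext
  change Finsupp.mapDomain _ _ = Finsupp.mapDomain _ (Finsupp.mapDomain _ _)
  rw [← Finsupp.mapDomain_comp]
  congr 1
  funext r
  exact mul_smul g h r

/-- The cusp `γ ∞`. -/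
def cusp (γ : SL(2, ℤ)) : OnePoint ℚ := SpecialLinearGroup.mapGL ℚ γ • OnePoint.infty

theorem cusp_mul (γ γ' : SL(2, ℤ)) :
    cusp (γ * γ') = SpecialLinearGroup.mapGL ℚ γ • cusp γ' := by
  rw [cusp, map_mul, mul_smul, cusp]

theorem cusp_eq_infty_iff (γ : SL(2, ℤ)) : cusp γ = OnePoint.infty ↔ γ 1 0 = 0 := by
  rw [cusp, OnePoint.smul_infty_eq_self_iff]
  simp

theorem cusp_one : cusp 1 = OnePoint.infty := (cusp_eq_infty_iff 1).2 (by simp)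

theorem cusp_T : cusp ModularGroup.T = OnePoint.infty :=
  (cusp_eq_infty_iff _).2 (by simp [ModularGroup.T])

theorem cusp_S : cusp ModularGroup.S = ((0 : ℚ) : OnePoint ℚ) := by
  rw [cusp, OnePoint.smul_infty_eq_ite]
  rw [mapGL_apply, mapGL_apply]
  simp [ModularGroup.S]

theorem cusp_surjective : Function.Surjective cusp := OnePoint.exists_mem_SL2 ℤ

/-- The unimodular symbol `γ((∞) - (0))`. -/
def unimodular (γ : SL(2, ℤ)) : Div0 :=
  actDiv (SpecialLinearGroup.mapGL ℚ γ) (divSub OnePoint.infty ((0 : ℚ) : OnePoint ℚ))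

theorem unimodular_eq (γ : SL(2, ℤ)) :
    unimodular γ = divSub (cusp γ) (cusp (γ * ModularGroup.S)) := by
  rw [unimodular, actDiv_divSub, cusp_mul, cusp_S, cusp]

theorem actDiv_unimodular (γ γ' : SL(2, ℤ)) :
    actDiv (SpecialLinearGroup.mapGL ℚ γ) (unimodular γ') = unimodular (γ * γ') := by
  rw [unimodular, ← actDiv_mul, ← map_mul, unimodular]

theorem divSub_self (r : OnePoint ℚ) : divSub r r = 0 := by
  apply Subtype.ext
  exact sub_self _

theorem neg_divSub (r s : OnePoint ℚ) : -divSub r s = divSub s r := by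
  apply Subtype.ext
  exact neg_sub _ _

theorem actDiv_mem_span_unimodular (γ : SL(2, ℤ)) {D : Div0}
    (h : D ∈ Submodule.span ℤ (Set.range unimodular)) :
    actDiv (SpecialLinearGroup.mapGL ℚ γ) D ∈ Submodule.span ℤ (Set.range unimodular) := by
  induction h using Submodule.span_induction with
  | mem x hx =>
    obtain ⟨γ', rfl⟩ := hx
    rw [actDiv_unimodular]
    exact Submodule.subset_span ⟨_, rfl⟩
  | zero => simp
  | add x y _ _ hx hy => rw [map_add]; exact add_mem hx hy
  | smul a x _ hx => rw [map_smul]; exact Submodule.smul_mem _ _ hx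

/-- The map `γ ↦ (γ∞) - (∞)` is a cocycle and the span is stable under `SL₂(ℤ)`, so the generators
`S` and `T` suffice. `T` fixes `∞`, and `S` gives minus a unimodular symbol. -/
theorem divSub_cusp_mem_span_unimodular (γ : SL(2, ℤ)) :
    divSub (cusp γ) OnePoint.infty ∈ Submodule.span ℤ (Set.range unimodular) := by
  have hγ : γ ∈ Subgroup.closure {ModularGroup.S, ModularGroup.T} := by
    rw [SpecialLinearGroup.SL2Z_generators]; trivial
  induction hγ using Subgroup.closure_induction with
  | mem x hx =>
    rcases hx with rfl | rfl
    · rw [← neg_divSub]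
      refine neg_mem (Submodule.subset_span ⟨1, ?_⟩)
      rw [unimodular_eq, one_mul, cusp_one]
    · rw [cusp_T, divSub_self]
      exact zero_mem _
  | one => rw [cusp_one, divSub_self]; exact zero_mem _
  | mul x y _ _ hx hy =>
    have h := add_mem (actDiv_mem_span_unimodular x hy) hx
    rwa [actDiv_divSub, ← cusp_mul, ← cusp, divSub_add] at h
  | inv x _ hx =>
    have h := neg_mem (actDiv_mem_span_unimodular x⁻¹ hx)
    rwa [actDiv_divSub, ← cusp_mul, inv_mul_cancel, cusp_one, ← cusp, neg_divSub] at h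

/-- The homomorphism `Δ₀ → M`, `∑ aᵣ (r) ↦ ∑ aᵣ F(r)`. -/
def divEval (F : OnePoint ℚ → M) : Div0 →ₗ[ℤ] M :=
  Finsupp.linearCombination ℤ F ∘ₗ Div0.subtype

theorem divEval_divSub (F : OnePoint ℚ → M) (r s : OnePoint ℚ) :
    divEval F (divSub r s) = F r - F s := by
  simp [divEval, divSub]

theorem linearCombination_divSub (D : Div0) :
    Finsupp.linearCombination ℤ (fun r => divSub r OnePoint.infty) D.1 = D := by
  -- On divisors of any degree the sum is `D - deg(D) (∞)`; the correction vanishes on `Δ₀`.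
  have h : Div0.subtype ∘ₗ Finsupp.linearCombination ℤ (fun r => divSub r OnePoint.infty) =
      LinearMap.id - (LinearMap.toSpanSingleton ℤ _ (Finsupp.single OnePoint.infty (1 : ℤ))) ∘ₗ
        Finsupp.linearCombination ℤ (fun _ : OnePoint ℚ => (1 : ℤ)) := by
    ext r : 2
    simp [divSub]
  apply Subtype.ext
  have h2 := LinearMap.congr_fun h D.1
  have h3 : Finsupp.linearCombination ℤ (fun _ : OnePoint ℚ => (1 : ℤ)) D.1 = 0 := D.2
  simpa [h3] using h2

theorem span_unimodular : Submodule.span ℤ (Set.range unimodular) = ⊤ := by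
  refine eq_top_iff.2 fun D _ => ?_
  rw [← linearCombination_divSub D, Finsupp.linearCombination_apply]
  refine Submodule.sum_mem _ fun r _ => Submodule.smul_mem _ _ ?_
  obtain ⟨γ, rfl⟩ := cusp_surjective r
  exact divSub_cusp_mem_span_unimodular γ

theorem hom_ext_unimodular {f g : Div0 →ₗ[ℤ] M}
    (h : ∀ γ, f (unimodular γ) = g (unimodular γ)) : f = g :=
  LinearMap.ext_on_range span_unimodular h

theorem eq_divEval {f : Div0 →ₗ[ℤ] M} {F : OnePoint ℚ → M}
    (h : ∀ γ, f (unimodular γ) = F (cusp γ) - F (cusp (γ * ModularGroup.S))) : f = divEval F :=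
  hom_ext_unimodular fun γ => by rw [h, unimodular_eq, divEval_divSub]

/-- A function of the bottom row of `γ ∈ SL₂(ℤ)` that is invariant under `± T` descends to
a function of the cusp `γ ∞`. -/
theorem exists_cusp_function {M : Type} (G : ℤ → ℤ → M) (hT : ∀ x y, G x (y + x) = G x y)
    (hneg : ∀ x y, G (-x) (-y) = G x y) :
    ∃ F : OnePoint ℚ → M, ∀ γ : SL(2, ℤ), F (cusp γ) = G (γ 1 0) (γ 1 1) := by
  have hT' : ∀ (k : ℤ) x y, G x (y + k * x) = G x y := fun k x => by
    induction k using Int.induction_on with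
    | zero => simp
    | succ i hi => intro y; rw [add_mul, one_mul, ← add_assoc, hT, hi]
    | pred i hi => intro y; rw [← hT, sub_mul, one_mul, add_assoc, sub_add_cancel, hi]
  choose s hs using cusp_surjective
  refine ⟨fun r => G (s r 1 0) (s r 1 1), fun γ => ?_⟩
  set γ' := s (cusp γ) with hγ'
  -- Two matrices with the same cusp differ by a stabilizer of `∞` in `SL₂(ℤ)`, that is, by `±T^k`.
  set g := γ⁻¹ * γ' with hg
  have h1 : g 1 0 = 0 := by
    rw [← cusp_eq_infty_iff, hg, cusp_mul, hs, ← cusp_mul, inv_mul_cancel, cusp_one]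
  have h2 : γ' = γ * g := by rw [hg, mul_inv_cancel_left]
  have h3 := g.det_coe
  rw [det_fin_two, h1, mul_zero, sub_zero] at h3
  change G (γ' 1 0) (γ' 1 1) = _
  have h4 : γ' 1 0 = γ 1 0 * g 0 0 := by
    rw [h2, SL_mul_apply, h1, mul_zero, add_zero]
  have h5 : γ' 1 1 = γ 1 0 * g 0 1 + γ 1 1 * g 1 1 := by
    rw [h2, SL_mul_apply]
  rw [h4, h5]
  rcases Int.eq_one_or_neg_one_of_mul_eq_one' h3 with ⟨h6, h7⟩ | ⟨h6, h7⟩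
  · rw [h6, h7, mul_one, mul_one, add_comm, mul_comm (γ 1 0), hT']
  · rw [h6, h7, ← hneg, ← hT' (-g 0 1) (γ 1 0) (γ 1 1)]
    congr 1 <;> ring

/-! ### Manin relations -/

/-- A function satisfying the Manin relations. -/
structure IsManin (e : ZMod N → ZMod N → M) : Prop where
  zero_right : ∀ x, e x 0 = 0
  two_term : ∀ x y, e x y + e y (-x) = 0
  three_term : ∀ x y, e x y = e x (x + y) + e (x + y) y

namespace IsManin

variable {e : ZMod N → ZMod N → M} (he : IsManin e)
include he

theorem zero_left (y : ZMod N) : e 0 y = 0 := by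
  have h := he.two_term (-y) 0
  rwa [he.zero_right, zero_add, neg_neg] at h

theorem diag (x : ZMod N) : e x x = 0 := by
  have h := he.three_term x 0
  simpa [he.zero_right] using h.symm

theorem neg_neg (x y : ZMod N) : e (-x) (-y) = e x y := by
  have h1 := he.two_term x y
  have h2 := he.two_term y (-x)
  rw [← h2, add_comm (e x y)] at h1
  exact (add_left_cancel h1).symm

theorem anti (x : ZMod N) : e x (-x) = 0 := by
  have h := he.three_term x (-x)
  simpa [he.zero_right, he.zero_left] using h

end IsManin

/-- The primitive of a Manin symbol along the Euclidean algorithm. -/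
def euclidSum (e : ZMod N → ZMod N → M) (x : ℕ) (y : ℤ) : M :=
  -- The recursion is the wanted identity `G(x, y) = e(x, y) + G(y, -x)` with `y` first reduced
  -- modulo `x`. Stopping at `x = 1` loses nothing, because `e(1, 0) = 0` for a Manin symbol.
  if _h : x ≤ 1 then 0 else
    e x ((y % x : ℤ) : ZMod N) + euclidSum e (y % x).toNat (-x)
termination_by x
decreasing_by
  have h1 := Int.emod_lt_of_pos y (by omega : (0 : ℤ) < x)
  omega

/-- The even extension of `euclidSum` to negative first arguments. -/
def euclidSumInt (e : ZMod N → ZMod N → M) (x y : ℤ) : M :=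
  euclidSum e x.natAbs (if 0 ≤ x then y else -y)

theorem euclidSum_congr (e : ZMod N → ZMod N → M) (x : ℕ) {y y' : ℤ}
    (h : y % x = y' % x) : euclidSum e x y = euclidSum e x y' := by
  rw [euclidSum, h, ← euclidSum]

theorem euclidSumInt_add (e : ZMod N → ZMod N → M) (x y : ℤ) :
    euclidSumInt e x (y + x) = euclidSumInt e x y := by
  apply euclidSum_congr
  split_ifs with h
  · rw [Int.natAbs_of_nonneg h]; simp
  · rw [Int.ofNat_natAbs_of_nonpos (by omega), neg_add, Int.add_emod_right]

theorem euclidSumInt_neg (e : ZMod N → ZMod N → M) (x y : ℤ) :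
    euclidSumInt e (-x) (-y) = euclidSumInt e x y := by
  rw [euclidSumInt, euclidSumInt, Int.natAbs_neg]
  rcases lt_trichotomy x 0 with h | rfl | h
  · rw [if_pos (by omega), if_neg (by omega)]
  · rw [neg_zero, if_pos le_rfl, if_pos le_rfl, euclidSum, euclidSum.eq_def e _ y]; simp
  · rw [if_neg (by omega), if_pos (by omega), neg_neg]

/-- For `0 < y < x` this is the recursion itself. The sign symmetry and the rotation `(x, y) ↦ (y,
-x)`, compatible with `e` by the two-term relation, reduce to `|y| ≤ x`. Negative `y` is handled by
the three-term relation and induction on `|x| + |y|`. -/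
theorem euclidSumInt_sub {e : ZMod N → ZMod N → M} (he : IsManin e) (x y : ℤ)
    (hxy : IsCoprime x y) :
    euclidSumInt e x y - euclidSumInt e y (-x) = e x y := by
  set Q : ℤ → ℤ → Prop := fun x y => euclidSumInt e x y - euclidSumInt e y (-x) = e x y with hQ
  have hneg : ∀ x y, Q (-x) (-y) → Q x y := fun x y h => by
    simp only [hQ, euclidSumInt_neg, Int.cast_neg, he.neg_neg] at h ⊢
    exact h
  have hrot : ∀ x y, Q x y → Q y (-x) := fun x y h => by
    simp only [hQ, euclidSumInt_neg, Int.cast_neg] at h ⊢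
    rw [eq_neg_of_add_eq_zero_right (he.two_term x y), ← h, neg_sub]
  have hsmall : ∀ x y : ℤ, x.natAbs ≤ 1 → euclidSumInt e x y = 0 := fun x y h => by
    rw [euclidSumInt, euclidSum, dif_pos h]
  change Q x y
  induction hn : x.natAbs + y.natAbs using Nat.strong_induction_on generalizing x y with
  | _ n ih =>
  have key : ∀ x y : ℤ, IsCoprime x y → x.natAbs + y.natAbs = n → |y| ≤ x → Q x y := by
    clear hn hxy x y
    intro x y hxy hn hyx
    rcases le_or_gt x 1 with hx1 | hx1
    · have hx0 : x ≠ 0 := fun h => by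
        have hy0 : y = 0 := by rw [← abs_nonpos_iff]; exact hyx.trans h.le
        rw [h, hy0] at hxy
        exact not_isCoprime_zero_zero hxy
      have hx : x = 1 := by have := abs_nonneg y; omega
      rw [hx, abs_le] at hyx
      simp only [hQ]
      rw [hsmall x y (by omega), hsmall y (-x) (by omega), sub_zero, hx]
      obtain rfl | rfl | rfl : y = -1 ∨ y = 0 ∨ y = 1 := by omega
      · simpa using (he.anti 1).symm
      · simpa using (he.zero_right 1).symm
      · simpa using (he.diag 1).symm
    · rw [abs_le] at hyx
      have hy0 : y ≠ 0 := fun h => by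
        rw [h, isCoprime_zero_right, Int.isUnit_iff] at hxy
        omega
      have hyx1 : y ≠ x := fun h => by
        rw [h, isCoprime_self, Int.isUnit_iff] at hxy
        omega
      have hyx2 : y ≠ -x := fun h => by
        rw [h, IsCoprime.neg_right_iff, isCoprime_self, Int.isUnit_iff] at hxy
        omega
      have hpos : ∀ y : ℤ, 0 < y → y < x →
          euclidSumInt e x y = e x y + euclidSumInt e y (-x) := fun y h0 h1 => by
        have hm : y % ((x.natAbs : ℕ) : ℤ) = y := by
          rw [Int.natAbs_of_nonneg (by omega)]; exact Int.emod_eq_of_lt h0.le h1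
        rw [euclidSumInt, euclidSum, dif_neg (by omega), if_pos (by omega), hm, euclidSumInt,
          if_pos h0.le, Int.natAbs_of_nonneg (show 0 ≤ x by omega),
          show ((x.natAbs : ℕ) : ZMod N) = ((x : ℤ) : ZMod N) by
            rw [← Int.cast_natCast, Int.natAbs_of_nonneg (show 0 ≤ x by omega)],
          show y.toNat = y.natAbs by omega]
      rcases lt_or_gt_of_ne hy0 with hy | hy
      -- For `y < 0` the pair `(x + y, y)` is smaller, while `(x, x + y)` falls under the recursion
      -- and has the same `G` as `(x, y)`. Adding the two equations produces `e(x, x + y) + e(x + y,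
      -- y)`.
      · have h1 : Q (x + y) y := ih ((x + y).natAbs + y.natAbs) (by omega) _ _
          (by simpa using hxy.add_mul_left_left 1) rfl
        have h2 := hpos (x + y) (by omega) (by omega)
        have h3 : euclidSumInt e x (x + y) = euclidSumInt e x y := by
          rw [add_comm, euclidSumInt_add]
        have h4 : euclidSumInt e (x + y) (-x) = euclidSumInt e (x + y) y := by
          rw [← euclidSumInt_add]; congr 1; ring
        have h5 : euclidSumInt e y (-(x + y)) = euclidSumInt e y (-x) := by
          rw [← euclidSumInt_add]; congr 1; ring
        simp only [hQ] at h1 ⊢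
        rw [h5] at h1
        rw [h3, h4] at h2
        rw [h2, add_sub_assoc, h1, Int.cast_add, ← he.three_term]
      · simp only [hQ]
        rw [hpos y hy (by omega), add_sub_cancel_right]
  rcases le_total |y| |x| with h | h
  · rcases le_total 0 x with h0 | h0
    · exact key x y hxy hn (by rwa [abs_of_nonneg h0] at h)
    · refine hneg x y (key _ _ hxy.neg_neg (by omega) ?_)
      rwa [abs_neg, ← abs_of_nonpos h0]
  · rcases le_total 0 y with h0 | h0
    · refine hneg x y (hrot _ _ (key y (-x) hxy.symm.neg_right (by omega) ?_))
      rwa [abs_neg, ← abs_of_nonneg h0]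
    · have h1 := hrot _ _ (key (-y) x hxy.symm.neg_left (by omega) (by rwa [← abs_of_nonpos h0]))
      rwa [neg_neg] at h1

theorem bottomRow_mul_S (γ : SL(2, ℤ)) :
    (γ * ModularGroup.S) 1 0 = γ 1 1 ∧ (γ * ModularGroup.S) 1 1 = -γ 1 0 := by
  rw [SL_mul_apply, SL_mul_apply]
  simp [ModularGroup.S]

/-- If `γ` has bottom row `(x, y)`, then `γS` has bottom row `(y, -x)`, so the difference of the
cusp function at `γ∞` and `γ0` is `G(x, y) - G(y, -x)`. -/
theorem exists_hom_of_isManin {e : ZMod N → ZMod N → M} (he : IsManin e) :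
    ∃ f : Div0 →ₗ[ℤ] M, ∀ γ : SL(2, ℤ),
      f (unimodular γ) = e (γ 1 0 : ℤ) (γ 1 1 : ℤ) := by
  obtain ⟨F, hF⟩ := exists_cusp_function (euclidSumInt e) (euclidSumInt_add e)
    (euclidSumInt_neg e)
  refine ⟨divEval F, fun γ => ?_⟩
  rw [unimodular_eq, divEval_divSub, hF, hF, (bottomRow_mul_S γ).1, (bottomRow_mul_S γ).2]
  refine euclidSumInt_sub he _ _ ?_
  have h := γ.det_coe
  rw [det_fin_two] at h
  exact ⟨-γ 0 1, γ 0 0, by linarith⟩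

/-! ### Modular symbols with values in a right `Σ₀(N)`-module -/

variable (ρ : Representation ℤ (Sigma0 N)ᵐᵒᵖ M)

/-- Equivariance of a Manin symbol: `Σ₀(N)` acts through scaling by the upper left entry. -/
def IsEquivariant (e : ZMod N → ZMod N → M) : Prop :=
  ∀ (δ : Sigma0 N) (x y : ZMod N), ρ (op δ) (e x y) =
    e ((δ : Matrix (Fin 2) (Fin 2) ℤ) 0 0 * x) ((δ : Matrix (Fin 2) (Fin 2) ℤ) 0 0 * y)

theorem toGL_gammaToSigma (γ : Gamma0 N) :
    toGL N (gammaToSigma N γ) = SpecialLinearGroup.mapGL ℚ (γ : SL(2, ℤ)) := by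
  apply Units.ext
  ext i j
  rfl

theorem lowerRight_mul_upperLeft (γ : Gamma0 N) :
    (((γ : SL(2, ℤ)) 0 0 : ℤ) : ZMod N) * (((γ : SL(2, ℤ)) 1 1 : ℤ) : ZMod N) = 1 := by
  have h := congrArg (Int.cast : ℤ → ZMod N) (γ : SL(2, ℤ)).det_coe
  rw [det_fin_two] at h
  push_cast at h
  rwa [Gamma0_mem.1 γ.2, mul_zero, sub_zero] at h

-- Modulo `N`, an element of `Γ₀(N)` scales bottom rows by its lower right entry `d`, while its
-- action scales the arguments of `e` by `a`. The two cancel because `ad ≡ 1`.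
variable {ρ} in
theorem exists_symb {e : ZMod N → ZMod N → M} (he : IsManin e) (heq : IsEquivariant ρ e) :
    ∃ φ : Symb ρ, ∀ γ : SL(2, ℤ), φ.1 (unimodular γ) = e (γ 1 0 : ℤ) (γ 1 1 : ℤ) := by
  obtain ⟨f, hf⟩ := exists_hom_of_isManin he
  refine ⟨⟨f, fun γ D => ?_⟩, hf⟩
  rw [toGL_gammaToSigma]
  suffices h : (ρ (op (gammaToSigma N γ))) ∘ₗ f ∘ₗ
      actDiv (SpecialLinearGroup.mapGL ℚ (γ : SL(2, ℤ))) = f from LinearMap.congr_fun h D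
  refine hom_ext_unimodular fun γ' => ?_
  rw [LinearMap.comp_apply, LinearMap.comp_apply, actDiv_unimodular, hf, hf, heq]
  have h1 := lowerRight_mul_upperLeft γ
  have h2 : ((((γ : SL(2, ℤ)) 1 0 : ℤ)) : ZMod N) = 0 := Gamma0_mem.1 γ.2
  change e (((γ : SL(2, ℤ)) 0 0 : ℤ) * _) (((γ : SL(2, ℤ)) 0 0 : ℤ) * _) = _
  rw [SL_mul_apply, SL_mul_apply]
  push_cast
  rw [h2, zero_mul, zero_mul, zero_add, zero_add, ← mul_assoc, ← mul_assoc, h1, one_mul, one_mul]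

/-! ### Hecke operators on modular symbols -/

section HeckeSymb

variable (ρ : Representation ℤ (Sigma0 N)ᵐᵒᵖ M) [NeZero N]

/-- The Hecke operator on homomorphisms `Δ₀ → M`: `D ↦ ∑ φ(δ D)|δ`. -/
def heckeHom (α : Sigma0 N) (f : Div0 →ₗ[ℤ] M) : Div0 →ₗ[ℤ] M :=
  ∑ q : Cosets α, ρ (op (repr q)) ∘ₗ f ∘ₗ actDiv (toGL N (repr q))

theorem heckeHom_apply (α : Sigma0 N) (f : Div0 →ₗ[ℤ] M) (D : Div0) :
    heckeHom ρ α f D = ∑ q : Cosets α, ρ (op (repr q)) (f (actDiv (toGL N (repr q)) D)) := by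
  rw [heckeHom, LinearMap.sum_apply]
  rfl

/-- The Hecke operator on the cocycle of a modular symbol agrees, up to a coboundary, with the
Hecke operator on modular symbols. -/
theorem heckeCocycle_symbCocycle (α : Sigma0 N) (φ : Symb ρ) :
    ∃ w : M, ∀ γ : Gamma0 N, heckeCocycle ρ α (symbCocycle ρ φ) γ =
      heckeHom ρ α φ.1 (divSub (cusp γ) OnePoint.infty) + (leftRep ρ γ w - w) := by
  -- The coboundary appears because `δ_q` moves `∞`. From `δ_q γ = γ_q δ_{qγ}`, the divisor `(γ_q∞)
  -- - (∞)` equals `δ_q((γ∞) - (∞)) + γ_q((∞) - (δ_{qγ}∞)) - ((∞) - (δ_q∞))`.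
  refine ⟨∑ q : Cosets α, ρ (op (repr q))
    (φ.1 (divSub OnePoint.infty (toGL N (repr q) • OnePoint.infty))), fun γ => ?_⟩
  rw [heckeCocycle_apply, heckeHom_apply, map_sum,
    ← (translateEquiv α γ).sum_comp (fun q => leftRep ρ γ _), ← Finset.sum_sub_distrib,
    ← Finset.sum_add_distrib]
  refine Finset.sum_congr rfl fun q _ => ?_
  change ρ _ (φ.1 (divSub (toGL N (gammaToSigma N (correction γ q)) • OnePoint.infty) _)) =
    _ + (leftRep ρ γ (ρ (op (repr (translate γ q))) _) - _)
  rw [← act_correction, ← Symb.apply_act, actDiv_divSub, actDiv_divSub, ← mul_smul, ← map_mul,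
    show repr (translateEquiv α γ q) = repr (translate γ q) from rfl,
    ← correction_spec, map_mul, mul_smul, toGL_gammaToSigma γ, ← cusp, ← map_sub, ← map_add,
    ← map_sub, ← map_add]
  refine congrArg (ρ _) (congrArg φ.1 ?_)
  generalize toGL N (gammaToSigma N (correction γ q)) • (OnePoint.infty : OnePoint ℚ) = a
  generalize toGL N (repr q) • cusp γ = b
  generalize toGL N (repr q) • (OnePoint.infty : OnePoint ℚ) = c
  rw [← divSub_add a b OnePoint.infty,
    ← divSub_add b c OnePoint.infty, ← neg_divSub OnePoint.infty c]
  abel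

end HeckeSymb

/-! ### Representatives of the cosets -/

section Reps

variable (m : ℕ) [Fact m.Prime]

/-- Representatives of the integral matrices of determinant `m`, modulo `SL₂(ℤ)` on the left. -/
def hermiteRep : Option (ZMod m) → Matrix (Fin 2) (Fin 2) ℤ
  | none => !![(m : ℤ), 0; 0, 1]
  | some j => !![1, j.valMinAbs; 0, (m : ℤ)]

omit [Fact m.Prime] in
theorem det_hermiteRep (k : Option (ZMod m)) : (hermiteRep m k).det = m := by
  cases k <;> simp [hermiteRep, det_fin_two]

/-- The determinant vanishes modulo the prime `m`, so the columns are dependent there: either the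
first column is zero modulo `m`, or the second is `j` times the first. -/
theorem exists_eq_mul_hermiteRep (A : Matrix (Fin 2) (Fin 2) ℤ) (hA : A.det = m) :
    ∃ (k : Option (ZMod m)) (β : SL(2, ℤ)), A = (β : Matrix (Fin 2) (Fin 2) ℤ) * hermiteRep m k := by
  have hm : (m : ℤ) ≠ 0 := Nat.cast_ne_zero.2 (Fact.out : m.Prime).ne_zero
  rw [det_fin_two] at hA
  by_cases h : (m : ℤ) ∣ A 0 0 ∧ (m : ℤ) ∣ A 1 0
  · obtain ⟨⟨a, ha⟩, ⟨c, hc⟩⟩ := h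
    have hdet : (!![a, A 0 1; c, A 1 1] : Matrix (Fin 2) (Fin 2) ℤ).det = 1 := by
      apply mul_left_cancel₀ hm
      rw [det_fin_two_of, mul_one]
      rw [ha, hc] at hA
      linarith
    refine ⟨none, ⟨_, hdet⟩, ?_⟩
    ext i j
    fin_cases i <;> fin_cases j <;>
      simp [hermiteRep, Matrix.mul_apply, Fin.sum_univ_two, ha, hc, mul_comm]
  · have hA' := congrArg (Int.cast : ℤ → ZMod m) hA
    push_cast at hA'
    rw [ZMod.natCast_self, sub_eq_zero] at hA'
    have hj : ∃ j : ZMod m, j * (A 0 0 : ℤ) = (A 0 1 : ℤ) ∧ j * (A 1 0 : ℤ) = (A 1 1 : ℤ) := by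
      by_cases h0 : ((A 0 0 : ℤ) : ZMod m) = 0
      · have h1 : ((A 1 0 : ℤ) : ZMod m) ≠ 0 := fun h1 =>
          h ⟨(ZMod.intCast_zmod_eq_zero_iff_dvd _ _).1 h0,
            (ZMod.intCast_zmod_eq_zero_iff_dvd _ _).1 h1⟩
        rw [h0, zero_mul, eq_comm, mul_eq_zero, or_iff_left h1] at hA'
        exact ⟨(A 1 1 : ℤ) / (A 1 0 : ℤ), by rw [h0, hA', mul_zero], div_mul_cancel₀ _ h1⟩
      · refine ⟨(A 0 1 : ℤ) / (A 0 0 : ℤ), div_mul_cancel₀ _ h0, ?_⟩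
        rw [div_mul_eq_mul_div, ← hA', mul_div_cancel_left₀ _ h0]
    obtain ⟨j, h0, h1⟩ := hj
    rw [← ZMod.coe_valMinAbs j, ← Int.cast_mul] at h0 h1
    obtain ⟨b, hb⟩ := (ZMod.intCast_eq_intCast_iff_dvd_sub _ _ _).1 h0
    obtain ⟨d, hd⟩ := (ZMod.intCast_eq_intCast_iff_dvd_sub _ _ _).1 h1
    have hdet : (!![A 0 0, b; A 1 0, d] : Matrix (Fin 2) (Fin 2) ℤ).det = 1 := by
      apply mul_left_cancel₀ hm
      rw [det_fin_two_of, mul_one]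
      linear_combination hA - (A 0 0) * hd + A 1 0 * hb
    refine ⟨some j, ⟨_, hdet⟩, ?_⟩
    ext i k
    fin_cases i <;> fin_cases k <;>
      simp [hermiteRep, Matrix.mul_apply, Fin.sum_univ_two]
    · linear_combination hb
    · linear_combination hd

variable {m}

variable (hm : 0 < m)

omit [Fact m.Prime] in
theorem det_repr (q : Cosets (diagOne N m hm)) :
    (repr q : Matrix (Fin 2) (Fin 2) ℤ).det = m := by
  rw [repr, det_of_mem_doubleCoset q.out.2]
  simp [diagOne, det_fin_two]

/-- The matrix `diag(m, 1)`. -/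
def diagLeft (hmN : IsCoprime (m : ℤ) (N : ℤ)) : Sigma0 N :=
  ⟨!![(m : ℤ), 0; 0, 1], by simpa [det_fin_two] using hm, hmN, by simp⟩

/-- The matrix `(1, j; 0, m)`. -/
def upperRep (j : ℤ) : Sigma0 N :=
  ⟨!![1, j; 0, (m : ℤ)], by simpa [det_fin_two] using hm, by simp [isCoprime_one_left], by simp⟩

omit [Fact m.Prime] in
theorem upperRep_mem (j : ℤ) : upperRep hm j ∈ doubleCoset (diagOne N m hm) := by
  refine ⟨1, ⟨⟨!![1, j; 0, 1], by simp [det_fin_two]⟩, Gamma0_mem.2 Int.cast_zero⟩, ?_⟩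
  apply Subtype.ext
  rw [map_one, one_mul]
  change !![1, j; 0, (m : ℤ)] = !![1, 0; 0, (m : ℤ)] * !![1, j; 0, 1]
  simp

-- The two elements of `Γ₀(N)` are built from a Bézout relation `sm + tN = 1`; both have determinant
-- `ms + tN`.
omit [Fact m.Prime] in
theorem diagLeft_mem (hmN : IsCoprime (m : ℤ) (N : ℤ)) :
    diagLeft hm hmN ∈ doubleCoset (diagOne N m hm) := by
  obtain ⟨s, t, h⟩ := hmN
  refine ⟨⟨⟨!![m * s, t; -N, 1], by rw [det_fin_two_of]; linarith⟩,
      Gamma0_mem.2 (show ((-N : ℤ) : ZMod N) = 0 by simp)⟩,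
    ⟨⟨!![(m : ℤ), -t; N, s], by rw [det_fin_two_of]; linarith⟩,
      Gamma0_mem.2 (show ((N : ℤ) : ZMod N) = 0 by simp)⟩, ?_⟩
  apply Subtype.ext
  change !![(m : ℤ), 0; 0, 1] =
    !![(m : ℤ) * s, t; -N, 1] * !![1, 0; 0, (m : ℤ)] * !![(m : ℤ), -t; N, s]
  ext i j
  fin_cases i <;> fin_cases j <;> simp
  · linear_combination -(m : ℤ) * h
  · ring
  · ring
  · linear_combination -h

/-- The `m + 1` standard matrices are pairwise inequivalent: `diag(m, 1)` has first column divisible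
by `m`, and an equivalence between two upper triangular ones makes their `j` congruent modulo `m`.
This lower bound turns an injection of cosets into Hermite forms into a bijection. -/
theorem card_le_card_cosets [NeZero N] (hmN : IsCoprime (m : ℤ) (N : ℤ)) :
    Nat.card (Option (ZMod m)) ≤ Nat.card (Cosets (diagOne N m hm)) := by
  refine Nat.card_le_card_of_injective
    (fun k => k.elim (Quotient.mk _ ⟨_, diagLeft_mem hm hmN⟩)
      fun j => Quotient.mk _ ⟨_, upperRep_mem hm j.valMinAbs⟩) ?_
  have hentry : ∀ (δ δ' : Sigma0 N) (γ : Gamma0 N), δ' = gammaToSigma N γ * δ → ∀ i j,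
      (δ' : Matrix (Fin 2) (Fin 2) ℤ) i j =
        (γ : SL(2, ℤ)) i 0 * (δ : Matrix (Fin 2) (Fin 2) ℤ) 0 j +
        (γ : SL(2, ℤ)) i 1 * (δ : Matrix (Fin 2) (Fin 2) ℤ) 1 j := by
    rintro δ δ' γ rfl i j
    change (((γ : SL(2, ℤ)) : Matrix (Fin 2) (Fin 2) ℤ) * (δ : Matrix (Fin 2) (Fin 2) ℤ)) i j = _
    rw [Matrix.mul_apply, Fin.sum_univ_two]
  have hne : ∀ (j : ℤ) (γ : Gamma0 N),
      upperRep hm j ≠ gammaToSigma N γ * diagLeft hm hmN := fun j γ h => by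
    have h1 := hentry _ _ _ h 0 0
    simp only [upperRep, diagLeft, of_apply, cons_val', cons_val_zero, cons_val_one] at h1
    have h2 : (m : ℤ) ∣ 1 := ⟨(γ : SL(2, ℤ)) 0 0, by simpa [mul_comm] using h1⟩
    have h3 := (Fact.out : m.Prime).two_le
    have h4 := Int.le_of_dvd one_pos h2
    omega
  rintro (_ | j) (_ | j') h
  · rfl
  · obtain ⟨γ, h⟩ := Quotient.exact h
    exact (hne _ _ h).elim
  · obtain ⟨γ, h⟩ := Quotient.exact h.symm
    exact (hne _ _ h).elim
  · obtain ⟨γ, h⟩ := Quotient.exact h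
    have h1 := hentry _ _ _ h 0 0
    have h2 := hentry _ _ _ h 0 1
    simp only [upperRep, of_apply, cons_val', cons_val_zero, cons_val_one] at h1 h2
    have h3 := congrArg (Int.cast : ℤ → ZMod m) h2
    rw [mul_zero, add_zero, mul_one] at h1
    rw [← h1] at h3
    simp only [one_mul, Int.cast_add, Int.cast_mul, Int.cast_natCast, ZMod.natCast_self, mul_zero,
      add_zero, ZMod.coe_valMinAbs] at h3
    rw [h3]

/-- For every `γ ∈ SL₂(ℤ)`, right multiplication by `γ` matches the cosets `Γ₀(N) δ` in the double
coset of `diag(1, m)` with the cosets of `SL₂(ℤ)` in the matrices of determinant `m`. -/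
theorem exists_cosets_equiv [NeZero N] (hmN : IsCoprime (m : ℤ) (N : ℤ)) (γ : SL(2, ℤ)) :
    ∃ κ : Cosets (diagOne N m hm) ≃ Option (ZMod m), ∀ q, ∃ β : SL(2, ℤ),
      (repr q : Matrix (Fin 2) (Fin 2) ℤ) * (γ : Matrix (Fin 2) (Fin 2) ℤ) =
        (β : Matrix (Fin 2) (Fin 2) ℤ) * hermiteRep m (κ q) := by
  have h := fun q : Cosets (diagOne N m hm) => exists_eq_mul_hermiteRep m
    ((repr q : Matrix (Fin 2) (Fin 2) ℤ) * (γ : Matrix (Fin 2) (Fin 2) ℤ))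
    (by rw [det_mul, det_repr, γ.det_coe, mul_one])
  choose κ β hκ using h
  have hinj : Function.Injective κ := fun q q' hq => by
    rw [← Quotient.out_eq q, ← Quotient.out_eq q']
    apply Quotient.sound
    -- Equal Hermite forms make the representatives differ by `g ∈ SL₂(ℤ)`. Both first columns are
    -- `(unit, 0)` modulo `N`, which forces `g` into `Γ₀(N)`.
    set g : SL(2, ℤ) := β q' * (β q)⁻¹ with hg
    have hrepr : ∀ q, (repr q : Matrix (Fin 2) (Fin 2) ℤ) =
        (β q : Matrix (Fin 2) (Fin 2) ℤ) * hermiteRep m (κ q) *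
          ((γ⁻¹ : SL(2, ℤ)) : Matrix (Fin 2) (Fin 2) ℤ) := fun q => by
      rw [← hκ, Matrix.mul_assoc, ← SL_coe_mul, mul_inv_cancel, SL_coe_one, Matrix.mul_one]
    have hmul : (repr q' : Matrix (Fin 2) (Fin 2) ℤ) =
        (g : Matrix (Fin 2) (Fin 2) ℤ) * (repr q : Matrix (Fin 2) (Fin 2) ℤ) := by
      rw [hrepr, hrepr q, ← hq, ← Matrix.mul_assoc, ← Matrix.mul_assoc,
        ← SL_coe_mul, hg, inv_mul_cancel_right]
    refine ⟨⟨g, Gamma0_mem.2 ?_⟩, Subtype.ext hmul⟩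
    have h1 := congrArg (Int.cast : ℤ → ZMod N) (congrFun (congrFun hmul 1) 0)
    rw [Matrix.mul_apply, Fin.sum_univ_two] at h1
    push_cast at h1
    rw [(ZMod.intCast_zmod_eq_zero_iff_dvd _ _).2 (repr q).2.2.2,
      (ZMod.intCast_zmod_eq_zero_iff_dvd _ _).2 (repr q').2.2.2, mul_zero, add_zero] at h1
    exact ((ZMod.coe_int_isUnit_iff_isCoprime _ _).2 (repr q).2.2.1.symm).mul_left_eq_zero.1 h1.symm
  have : NeZero m := ⟨hm.ne'⟩
  exact ⟨Equiv.ofBijective κ (hinj.bijective_of_nat_card_le (card_le_card_cosets hm hmN)),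
    fun q => ⟨β q, hκ q⟩⟩

/-! ### Hecke operators on unimodular symbols -/

variable (m) in
/-- The matrix `hermiteRep m k` in `GL₂(ℚ)`. -/
def hermiteGL (k : Option (ZMod m)) : GL (Fin 2) ℚ :=
  GeneralLinearGroup.mkOfDetNeZero ((hermiteRep m k).map (Int.castRingHom ℚ)) (by
    rw [← RingHom.mapMatrix_apply, ← RingHom.map_det, det_hermiteRep]
    simpa using (Fact.out : m.Prime).ne_zero)

theorem hermiteGL_none :
    actDiv (hermiteGL m none) (divSub OnePoint.infty ((0 : ℚ) : OnePoint ℚ)) = unimodular 1 := by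
  have h : ∀ i j, hermiteGL m none i j = (hermiteRep m none i j : ℚ) := fun _ _ => rfl
  rw [unimodular, actDiv_divSub, actDiv_divSub, OnePoint.smul_infty_eq_ite,
    OnePoint.smul_some_eq_ite]
  simp only [h]
  simp [hermiteRep]

theorem hermiteGL_some_of_eq_zero (j : ZMod m) (hj : j.valMinAbs = 0) :
    actDiv (hermiteGL m (some j)) (divSub OnePoint.infty ((0 : ℚ) : OnePoint ℚ)) =
      unimodular 1 := by
  have h : ∀ i k, hermiteGL m (some j) i k = (hermiteRep m (some j) i k : ℚ) := fun _ _ => rfl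
  have hm := (Fact.out : m.Prime).ne_zero
  rw [unimodular, actDiv_divSub, actDiv_divSub, OnePoint.smul_infty_eq_ite,
    OnePoint.smul_some_eq_ite]
  simp only [h]
  simp [hermiteRep, hj, hm]

/-- A matrix sending `∞` to `0` and `0` to `1 / a`. -/
def lowerMat (a : ℤ) : SL(2, ℤ) := ⟨!![0, -1; 1, -a], by simp [det_fin_two]⟩

/-- The path from `∞` to `j/m` is broken at `0`. The second piece is unimodular because `j/m =
1/(jm)` when `j = ±1`; larger residues would need longer continued fractions. -/
theorem hermiteGL_some (j : ZMod m) (hj : j.valMinAbs * j.valMinAbs = 1) :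
    actDiv (hermiteGL m (some j)) (divSub OnePoint.infty ((0 : ℚ) : OnePoint ℚ)) =
      unimodular 1 + unimodular (lowerMat (j.valMinAbs * m)) := by
  have h : ∀ i k, hermiteGL m (some j) i k = (hermiteRep m (some j) i k : ℚ) := fun _ _ => rfl
  have hm := (Fact.out : m.Prime).ne_zero
  have hj0 : j.valMinAbs ≠ 0 := fun h => by simp [h] at hj
  have hj0' : (j.valMinAbs : ℚ) ≠ 0 := Int.cast_ne_zero.2 hj0
  have hj' : (j.valMinAbs : ℚ) * j.valMinAbs = 1 := by exact_mod_cast hj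
  have h1 : unimodular 1 = divSub OnePoint.infty ((0 : ℚ) : OnePoint ℚ) := by
    rw [unimodular_eq, one_mul, cusp_one, cusp_S]
  have h2 : cusp (lowerMat (j.valMinAbs * m)) = ((0 : ℚ) : OnePoint ℚ) := by
    rw [cusp, OnePoint.smul_infty_eq_ite, mapGL_apply, mapGL_apply]
    simp [lowerMat]
  have h3 : cusp (lowerMat (j.valMinAbs * m) * ModularGroup.S) =
      (((j.valMinAbs : ℚ) / m : ℚ) : OnePoint ℚ) := by
    rw [cusp, OnePoint.smul_infty_eq_ite, mapGL_apply, mapGL_apply, SL_mul_apply, SL_mul_apply]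
    simp only [lowerMat, ModularGroup.S]
    have h5 : (1 : ℚ) / (j.valMinAbs * m) = j.valMinAbs / m := by
      field_simp
      linear_combination -hj'
    simp [hj0, hm, ← h5]
  rw [h1, unimodular_eq, h2, h3, divSub_add, actDiv_divSub, OnePoint.smul_infty_eq_ite,
    OnePoint.smul_some_eq_ite]
  simp only [h]
  simp [hermiteRep, hm]

variable {ρ : Representation ℤ (Sigma0 N)ᵐᵒᵖ M} {e : ZMod N → ZMod N → M}

omit [Fact m.Prime] in
/-- If `δ γ = β η` with `δ ∈ Σ₀(N)` of determinant `m`, then `φ(β γ'(∞ - 0))|δ` only depends on the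
bottom row of `γ η* γ'`, where `η*` is the adjugate. -/
theorem act_apply_unimodular (heq : IsEquivariant ρ e) (f : Div0 →ₗ[ℤ] M)
    (hf : ∀ γ : SL(2, ℤ), f (unimodular γ) = e (γ 1 0 : ℤ) (γ 1 1 : ℤ))
    (hmN : IsCoprime (m : ℤ) (N : ℤ)) (δ : Sigma0 N)
    (hδ : (δ : Matrix (Fin 2) (Fin 2) ℤ).det = m) (γ β γ' : SL(2, ℤ))
    (η : Matrix (Fin 2) (Fin 2) ℤ) (hη : η.det = m)
    (h : (δ : Matrix (Fin 2) (Fin 2) ℤ) * (γ : Matrix (Fin 2) (Fin 2) ℤ) =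
      (β : Matrix (Fin 2) (Fin 2) ℤ) * η) :
    ρ (op δ) (f (unimodular (β * γ'))) =
      e (((γ : Matrix (Fin 2) (Fin 2) ℤ) * η.adjugate * (γ' : Matrix (Fin 2) (Fin 2) ℤ)) 1 0 : ℤ)
        (((γ : Matrix (Fin 2) (Fin 2) ℤ) * η.adjugate * (γ' : Matrix (Fin 2) (Fin 2) ℤ)) 1 1 : ℤ) := by
  set A : Matrix (Fin 2) (Fin 2) ℤ := (γ : Matrix (Fin 2) (Fin 2) ℤ) * η.adjugate * γ' with hA
  -- This removes `β` in favour of `δ`. On bottom rows modulo `N`, `δ` acts by its lower right entry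
  -- `d`; multiplying by its upper left entry `a`, with `ad ≡ m`, and cancelling the unit `m` gives
  -- the claim.
  have h1 : (m : ℤ) • (β * γ' : SL(2, ℤ)).1 = (δ : Matrix (Fin 2) (Fin 2) ℤ) * A := by
    rw [SL_coe_mul, hA, ← Matrix.mul_assoc, ← Matrix.mul_assoc, h,
      Matrix.mul_assoc (β : Matrix (Fin 2) (Fin 2) ℤ), mul_adjugate, hη, Matrix.mul_smul, Matrix.mul_one, Matrix.smul_mul]
  have hmu : IsUnit ((m : ℤ) : ZMod N) := (ZMod.coe_int_isUnit_iff_isCoprime _ _).2 hmN.symm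
  have hdet := congrArg (Int.cast : ℤ → ZMod N) hδ
  have h10 : (((δ : Matrix (Fin 2) (Fin 2) ℤ) 1 0 : ℤ) : ZMod N) = 0 :=
    (ZMod.intCast_zmod_eq_zero_iff_dvd _ _).2 δ.2.2.2
  rw [det_fin_two] at hdet
  simp only [Int.cast_sub, Int.cast_mul, h10, mul_zero, sub_zero] at hdet
  have h2 : ∀ j, (((δ : Matrix (Fin 2) (Fin 2) ℤ) 0 0 : ℤ) : ZMod N) *
      ((β * γ' : SL(2, ℤ)).1 1 j : ℤ) = (A 1 j : ℤ) := fun j => by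
    have h3 := congrArg (Int.cast : ℤ → ZMod N) (congrFun (congrFun h1 1) j)
    rw [Matrix.mul_apply, Fin.sum_univ_two, Matrix.smul_apply, smul_eq_mul] at h3
    simp only [Int.cast_add, Int.cast_mul, h10, zero_mul, zero_add] at h3
    apply hmu.mul_left_cancel
    rw [mul_left_comm, h3, ← mul_assoc, hdet]
  rw [hf, heq]
  exact congrArg₂ e (h2 0) (h2 1)

/-- The value of a modular symbol `φ|T_m` on unimodular symbols, in terms of Manin symbols, when
the minimal residues modulo `m` are at most `1`. -/
theorem heckeHom_unimodular [NeZero N] (heq : IsEquivariant ρ e) (f : Div0 →ₗ[ℤ] M)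
    (hf : ∀ γ : SL(2, ℤ), f (unimodular γ) = e (γ 1 0 : ℤ) (γ 1 1 : ℤ))
    (hmN : IsCoprime (m : ℤ) (N : ℤ))
    (hres : ∀ j : ZMod m, j.valMinAbs = 0 ∨ j.valMinAbs * j.valMinAbs = 1) (γ : SL(2, ℤ)) :
    heckeHom ρ (diagOne N m hm) f (unimodular γ) =
      e (γ 1 0 : ℤ) (m * (γ 1 1 : ℤ)) + ∑ j : ZMod m,
        (e (m * (γ 1 0 : ℤ)) ((γ 1 1 : ℤ) - j.valMinAbs * (γ 1 0 : ℤ)) +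
          if j.valMinAbs = 0 then 0 else
            e ((γ 1 1 : ℤ) - j.valMinAbs * (γ 1 0 : ℤ)) (-(j.valMinAbs * m * (γ 1 1 : ℤ)))) := by
  obtain ⟨κ, hκ⟩ := exists_cosets_equiv hm hmN γ
  set B : Option (ZMod m) → M := fun k => k.elim (e (γ 1 0 : ℤ) (m * (γ 1 1 : ℤ)))
    fun j => e (m * (γ 1 0 : ℤ)) ((γ 1 1 : ℤ) - j.valMinAbs * (γ 1 0 : ℤ)) +
      if j.valMinAbs = 0 then 0 else
        e ((γ 1 1 : ℤ) - j.valMinAbs * (γ 1 0 : ℤ)) (-(j.valMinAbs * m * (γ 1 1 : ℤ))) with hB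
  suffices h : heckeHom ρ (diagOne N m hm) f (unimodular γ) = ∑ k, B k by
    rw [h, Fintype.sum_option]
    rfl
  rw [heckeHom_apply, ← κ.sum_comp]
  refine Finset.sum_congr rfl fun q _ => ?_
  obtain ⟨β, hβ⟩ := hκ q
  set k := κ q
  have hGL : toGL N (repr q) * SpecialLinearGroup.mapGL ℚ γ =
      SpecialLinearGroup.mapGL ℚ β * hermiteGL m k := by
    apply Units.ext
    have h1 := congrArg (fun A : Matrix (Fin 2) (Fin 2) ℤ => A.map (Int.castRingHom ℚ)) hβ
    rw [Matrix.map_mul, Matrix.map_mul] at h1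
    exact h1
  have hval := fun γ' => act_apply_unimodular heq f hf hmN (repr q) (det_repr hm q) γ β γ' _
    (det_hermiteRep m k) hβ
  rw [unimodular, ← actDiv_mul, hGL, actDiv_mul]
  have h1 := hval 1
  rw [mul_one, SL_coe_one, Matrix.mul_one, Matrix.mul_apply, Matrix.mul_apply,
    Fin.sum_univ_two, Fin.sum_univ_two, adjugate_fin_two] at h1
  rcases hk : k with _ | j
  · rw [hermiteGL_none, actDiv_unimodular, mul_one, h1, hk]
    simp [hB, hermiteRep, mul_comm]
  · rw [hk] at h1
    rcases hres j with hj | hj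
    · rw [hermiteGL_some_of_eq_zero j hj, actDiv_unimodular, mul_one, h1]
      simp only [hB, Option.elim_some, hermiteRep, hj]
      simp [mul_comm]
    · have hj0 : j.valMinAbs ≠ 0 := fun h => by simp [h] at hj
      have h2 := hval (lowerMat (j.valMinAbs * m))
      have hj2 : (j.valMinAbs : ZMod N) * j.valMinAbs = 1 := by
        exact_mod_cast congrArg (Int.cast : ℤ → ZMod N) hj
      rw [hk] at h2
      rw [hermiteGL_some j hj, map_add, map_add, map_add, actDiv_unimodular, actDiv_unimodular,
        mul_one, h1, h2]
      simp only [hB, Option.elim_some, if_neg hj0]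
      congr 1
      · simp [hermiteRep]
        congr 1 <;> ring
      · simp only [hermiteRep, lowerMat, adjugate_fin_two, Matrix.mul_apply, Fin.sum_univ_two]
        simp
        congr 1
        · ring
        -- With bottom row `(x, y)` of `γ`, the entry is `-mx - jm(y - jx)`, which is `-jmy` since
        -- `j² = 1`.
        · linear_combination (m : ZMod N) * (γ 1 0 : ℤ) * hj2

end Reps

/-! ### Eisenstein classes -/

/-- If the Hecke operator acts on Manin symbols through `τ + m`, up to a function supported on the
cusps over `∞`, then it acts on the parabolic class through `τ + m`. -/
theorem heckeT_symbToPar {m : ℕ} [Fact m.Prime] [NeZero N] (hm : 0 < m)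
    {ρ : Representation ℤ (Sigma0 N)ᵐᵒᵖ M} {e : ZMod N → ZMod N → M} (heq : IsEquivariant ρ e)
    (φ : Symb ρ) (hφ : ∀ γ : SL(2, ℤ), φ.1 (unimodular γ) = e (γ 1 0 : ℤ) (γ 1 1 : ℤ))
    (hmN : IsCoprime (m : ℤ) (N : ℤ))
    (hres : ∀ j : ZMod m, j.valMinAbs = 0 ∨ j.valMinAbs * j.valMinAbs = 1)
    (τ : M →ₗ[ℤ] M) (hτ : ∀ δ x, τ (ρ δ x) = ρ δ (τ x))
    (hτe : ∀ x y, τ (e x y) = e (m * x) (m * y))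
    (E : ZMod N → M) (hE : ∀ (δ : Sigma0 N) y,
      ρ (op δ) (E y) = E ((δ : Matrix (Fin 2) (Fin 2) ℤ) 0 0 * y))
    (hEneg : ∀ y, E (-y) = E y)
    (hrel : ∀ x y : ZMod N, e x (m * y) + ∑ j : ZMod m,
        (e (m * x) (y - j.valMinAbs * x) +
          if j.valMinAbs = 0 then 0 else e (y - j.valMinAbs * x) (-(j.valMinAbs * m * y))) =
      e (m * x) (m * y) + m • e x y + ((if x = 0 then E y else 0) - if y = 0 then E x else 0)) :
    heckeT ρ m hm (symbToPar ρ φ) = coeffPar τ hτ (symbToPar ρ φ) + m • symbToPar ρ φ := by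
  -- `F` lives on the `Γ₀(N)`-orbit of `∞`, where the left entry of the bottom row vanishes modulo
  -- `N`. Its boundary is the error term of `hrel`.
  obtain ⟨F, hF⟩ := exists_cusp_function
    (fun x y : ℤ => if (x : ZMod N) = 0 then E y else 0)
    (fun x y => by
      by_cases h : (x : ZMod N) = 0
      · simp [h]
      · simp [h])
    (fun x y => by simp [hEneg])
  have hΨ : heckeHom ρ (diagOne N m hm) φ.1 - (τ ∘ₗ φ.1 + m • φ.1) = divEval F := by
    refine eq_divEval fun γ => ?_
    rw [LinearMap.sub_apply, heckeHom_unimodular hm heq φ.1 hφ hmN hres, hrel, LinearMap.add_apply,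
      LinearMap.comp_apply, LinearMap.smul_apply, hφ, hτe, hF, hF, (bottomRow_mul_S γ).1,
      (bottomRow_mul_S γ).2, Int.cast_neg, hEneg]
    abel
  obtain ⟨w, hw⟩ := heckeCocycle_symbCocycle ρ (diagOne N m hm) φ
  obtain ⟨c', hc', hcl⟩ := coeffH1_classOf τ hτ (symbCocycle ρ φ)
  apply Subtype.ext
  change heckeH1 ρ _ (classOf ρ (symbCocycle ρ φ)) =
    coeffH1 τ hτ (classOf ρ (symbCocycle ρ φ)) + m • classOf ρ (symbCocycle ρ φ)
  rw [heckeH1_classOf, hcl, ← sub_eq_zero, ← map_nsmul, ← map_add, ← map_sub,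
    classOf_eq_zero_iff]
  -- One summand absorbs `F(γ∞) - F(∞)`, the other the passage from cocycles to modular symbols.
  refine ⟨F OnePoint.infty + w, fun γ => ?_⟩
  change heckeCocycle ρ (diagOne N m hm) (symbCocycle ρ φ) γ -
    (c' γ + m • symbCocycle ρ φ γ) = _
  have h1 := LinearMap.congr_fun hΨ (divSub (cusp γ) OnePoint.infty)
  have h2 : symbCocycle ρ φ γ = φ.1 (divSub (cusp γ) OnePoint.infty) := by
    rw [cusp, ← toGL_gammaToSigma]
    rfl
  rw [divEval_divSub, LinearMap.sub_apply, LinearMap.add_apply, LinearMap.comp_apply,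
    LinearMap.smul_apply] at h1
  -- Equivariance of `F` at `∞`: the bottom row of `γ` is `(0, d)` modulo `N`, and `d` is also the
  -- upper left entry of `γ⁻¹`, through which `γ` acts on the left.
  have h3 : F (cusp γ) = leftRep ρ γ (F OnePoint.infty) := by
    have h4 : ((((γ : SL(2, ℤ)) 1 0 : ℤ)) : ZMod N) = 0 := Gamma0_mem.1 γ.2
    have h5 : ((gammaToSigma N γ⁻¹ : Sigma0 N) : Matrix (Fin 2) (Fin 2) ℤ) 0 0 =
        (γ : SL(2, ℤ)) 1 1 := by
      change ((γ : SL(2, ℤ)) : Matrix (Fin 2) (Fin 2) ℤ).adjugate 0 0 = _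
      rw [adjugate_fin_two]
      rfl
    rw [← cusp_one, hF, hF, if_pos h4, leftRep_apply]
    change _ = ρ _ (if ((0 : ℤ) : ZMod N) = 0 then E (1 : ℤ) else 0)
    rw [if_pos Int.cast_zero, hE, h5, Int.cast_one, mul_one]
  rw [hw, hc', h2, map_add, ← h3, add_sub_right_comm, h1]
  abel

/-! ### Identities between Steinberg symbols -/

section Milnor

variable {R : Type} [CommRing R]

theorem steinberg_mul_left (a b c : Rˣ) :
    steinberg (a * b) c = steinberg a c + steinberg b c := by
  simp only [steinberg, ofMul_mul, TensorProduct.add_tmul, Submodule.Quotient.mk_add]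

theorem steinberg_mul_right (a b c : Rˣ) :
    steinberg a (b * c) = steinberg a b + steinberg a c := by
  simp only [steinberg, ofMul_mul, TensorProduct.tmul_add, Submodule.Quotient.mk_add]

theorem steinberg_one_left (a : Rˣ) : steinberg 1 a = 0 := by
  have h := steinberg_mul_left 1 1 a
  rwa [mul_one, left_eq_add] at h

theorem steinberg_one_right (a : Rˣ) : steinberg a 1 = 0 := by
  have h := steinberg_mul_right a 1 1
  rwa [mul_one, left_eq_add] at h

theorem steinberg_inv_left (a b : Rˣ) : steinberg a⁻¹ b = -steinberg a b := by
  rw [eq_neg_iff_add_eq_zero, ← steinberg_mul_left, inv_mul_cancel, steinberg_one_left]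

theorem steinberg_inv_right (a b : Rˣ) : steinberg a b⁻¹ = -steinberg a b := by
  rw [eq_neg_iff_add_eq_zero, ← steinberg_mul_right, inv_mul_cancel, steinberg_one_right]

theorem steinberg_pow_left (a b : Rˣ) (k : ℕ) : steinberg (a ^ k) b = k • steinberg a b := by
  induction k with
  | zero => rw [pow_zero, zero_smul, steinberg_one_left]
  | succ k ih => rw [pow_succ, steinberg_mul_left, ih, succ_nsmul]

theorem steinberg_of_add_eq {a b : Rˣ} (h : (a : R) + b = 0 ∨ (a : R) + b = 1) :
    steinberg a b = 0 := by
  have h1 : (Submodule.Quotient.mk (Additive.ofMul a ⊗ₜ[ℤ] Additive.ofMul b) : K2 R) = 0 :=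
    (Submodule.Quotient.mk_eq_zero _).2 (Submodule.subset_span ⟨a, b, h, rfl⟩)
  rw [steinberg, h1, Submodule.Quotient.mk_zero]

/-- Twice the symbol is `{1, a} = 0`; here the quotient by 2-torsion enters. -/
theorem steinberg_neg_one_left (a : Rˣ) : steinberg (-1) a = 0 := by
  refine (Submodule.Quotient.mk_eq_zero _).2 ((Submodule.mem_torsionBy_iff _ _).2 ?_)
  rw [← Submodule.Quotient.mk_smul, two_smul, ← TensorProduct.add_tmul, ← ofMul_mul]
  simp

theorem steinberg_neg_one_right (a : Rˣ) : steinberg a (-1) = 0 := by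
  refine (Submodule.Quotient.mk_eq_zero _).2 ((Submodule.mem_torsionBy_iff _ _).2 ?_)
  rw [← Submodule.Quotient.mk_smul, two_smul, ← TensorProduct.tmul_add, ← ofMul_mul]
  simp

theorem steinberg_self (a : Rˣ) : steinberg a a = 0 := by
  have h := steinberg_of_add_eq (a := a) (b := -1 * a) (Or.inl (by simp))
  rwa [steinberg_mul_right, steinberg_neg_one_right, zero_add] at h

theorem steinberg_swap (a b : Rˣ) : steinberg a b = -steinberg b a := by
  have h := steinberg_self (a * b)
  rw [steinberg_mul_left, steinberg_mul_right, steinberg_mul_right, steinberg_self, steinberg_self,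
    zero_add, add_zero] at h
  exact eq_neg_of_add_eq_zero_left h

/-- The units `a` with `{z, a} = 0`. -/
def nullUnits (z : Rˣ) : Subgroup Rˣ where
  carrier := {a | steinberg z a = 0}
  one_mem' := steinberg_one_right z
  mul_mem' {a b} ha hb := by
    rw [Set.mem_ofPred_eq] at ha hb ⊢
    rw [steinberg_mul_right, ha, hb, add_zero]
  inv_mem' {a} ha := by
    rw [Set.mem_ofPred_eq] at ha ⊢
    rw [steinberg_inv_right, ha, neg_zero]

/-- The units `± zⁱ`. -/
def signedPowers (z : Rˣ) : Subgroup Rˣ := Subgroup.closure {z, -1}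

theorem self_mem_signedPowers (z : Rˣ) : z ∈ signedPowers z := Subgroup.subset_closure (by simp)

theorem neg_one_mem_signedPowers (z : Rˣ) : -1 ∈ signedPowers z :=
  Subgroup.subset_closure (by simp)

theorem signedPowers_le_nullUnits (z : Rˣ) : signedPowers z ≤ nullUnits z := by
  refine (Subgroup.closure_le _).2 ?_
  rintro _ (rfl | rfl)
  · exact steinberg_self _
  · exact steinberg_neg_one_right z

theorem steinberg_eq_zero_of_mem {z w a : Rˣ} (hw : w ∈ signedPowers z) (ha : a ∈ nullUnits z) :
    steinberg w a = 0 := by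
  induction hw using Subgroup.closure_induction with
  | mem x hx =>
    rcases hx with rfl | rfl
    · exact ha
    · exact steinberg_neg_one_left a
  | one => exact steinberg_one_left a
  | mul x y _ _ hx hy => rw [steinberg_mul_left, hx, hy, add_zero]
  | inv x _ hx => rw [steinberg_inv_left, hx, neg_zero]

/-- The three-term relation: `{a, b} = {a, c} + {c, b}` if `c` is the sum of `a` and `b`, up to
factors `± zⁱ` with trivial symbols. -/
theorem steinberg_three_term {z a b c u v : Rˣ} (ha : a ∈ nullUnits z) (hb : b ∈ nullUnits z)
    (hc : c ∈ nullUnits z) (hu : u ∈ signedPowers z) (hv : v ∈ signedPowers z)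
    (h : (u : R) * a + v * b = c) : steinberg a b = steinberg a c + steinberg c b := by
  -- Dividing by `c` gives two units with sum `1`. The factors `u` and `v` then drop out, and
  -- bilinearity leaves `{a, b} - {a, c} - {c, b} = 0`.
  have h1 : steinberg (u * a * c⁻¹) (v * b * c⁻¹) = 0 := by
    refine steinberg_of_add_eq (Or.inr ?_)
    rw [Units.val_mul, Units.val_mul, Units.val_mul, Units.val_mul, ← add_mul, h, Units.mul_inv]
  have h2 : steinberg u (v * b * c⁻¹) = 0 := steinberg_eq_zero_of_mem hu
    (mul_mem (mul_mem (signedPowers_le_nullUnits z hv) hb) (inv_mem hc))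
  have h3 : steinberg v (a * c⁻¹) = 0 := steinberg_eq_zero_of_mem hv (mul_mem ha (inv_mem hc))
  rw [mul_assoc u, steinberg_mul_left, h2, zero_add, mul_assoc v, steinberg_mul_right,
    steinberg_swap _ v, h3, neg_zero, zero_add, steinberg_mul_left, steinberg_mul_right,
    steinberg_mul_right, steinberg_inv_left, steinberg_inv_left, steinberg_inv_right,
    steinberg_inv_right, steinberg_self] at h1
  rw [← sub_eq_zero, ← h1]
  abel

end Milnor

/-! ### Cyclotomic units -/

section Cyclotomic

variable {p n : ℕ} {K : Type} [Field K] [NumberField K] [Fact p.Prime]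
  {ζ : pIntegers p n K} (hζ : IsPrimitiveRoot ζ (p ^ n))

/-- A primitive root of unity, as a unit. -/
def rootUnit : (pIntegers p n K)ˣ := (hζ.isUnit (NeZero.ne _)).unit

omit [NumberField K] in
theorem rootUnit_val : (rootUnit hζ : pIntegers p n K) = ζ := rfl

omit [NumberField K] [Fact p.Prime] in
include hζ in
theorem pow_val_natCast (k : ℕ) : ζ ^ (k : ZMod (p ^ n)).val = ζ ^ k := by
  rw [ZMod.val_natCast]
  conv_rhs => rw [← Nat.mod_add_div k (p ^ n), pow_add, pow_mul, hζ.pow_eq_one, one_pow, mul_one]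

omit [NumberField K] in
include hζ in
theorem pow_val_add (x y : ZMod (p ^ n)) :
    ζ ^ (x + y).val = ζ ^ x.val * ζ ^ y.val := by
  rw [← pow_add, ← pow_val_natCast hζ (x.val + y.val), Nat.cast_add, ZMod.natCast_zmod_val,
    ZMod.natCast_zmod_val]

omit [NumberField K] in
include hζ in
theorem pow_val_mul (x y : ZMod (p ^ n)) : ζ ^ (x * y).val = (ζ ^ y.val) ^ x.val := by
  rw [← pow_mul, ← pow_val_natCast hζ (y.val * x.val), Nat.cast_mul, ZMod.natCast_zmod_val,
    ZMod.natCast_zmod_val, mul_comm]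

theorem oneSub_val (x : ZMod (p ^ n)) (hx : x ≠ 0) :
    (oneSub hζ x hx : pIntegers p n K) = 1 - ζ ^ x.val := IsUnit.unit_spec _

open Classical in
/-- The unit `1 - ζ ^ x` for `x ≠ 0`, and `1` for `x = 0`. -/
def cycUnit (x : ZMod (p ^ n)) : (pIntegers p n K)ˣ :=
  if h : x ≠ 0 then oneSub hζ x h else 1

theorem cycUnit_zero : cycUnit hζ 0 = 1 := dif_neg (by simp)

theorem cycUnit_val {x : ZMod (p ^ n)} (hx : x ≠ 0) :
    (cycUnit hζ x : pIntegers p n K) = 1 - ζ ^ x.val := by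
  rw [cycUnit, dif_pos hx, oneSub_val]

/-- The default value `1` at zero absorbs the case distinction, since `{1, ·} = {·, 1} = 0`. -/
theorem maninSymbol_eq (x y : ZMod (p ^ n)) :
    maninSymbol hζ x y = steinberg (cycUnit hζ x) (cycUnit hζ y) := by
  rw [maninSymbol]
  split_ifs with h
  · rw [cycUnit, cycUnit, dif_pos h.1, dif_pos h.2]
  · rw [not_and_or, not_not, not_not] at h
    rcases h with rfl | rfl
    · rw [cycUnit_zero, steinberg_one_left]
    · rw [cycUnit_zero, steinberg_one_right]

/-- The Steinberg relation gives `{ζ^k, 1 - ζ^k} = 0`, and `ζ` is a power of `ζ^k`. Working in the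
image inside the ring allows factorizations of ring elements to be used afterwards. -/
theorem one_sub_pow_mem_nullUnits {k : ℕ} (hk : k.Coprime p) (hn : 0 < n) :
    1 - ζ ^ k ∈ (nullUnits (rootUnit hζ)).toSubmonoid.map (Units.coeHom (pIntegers p n K)) := by
  have hk' : k.Coprime (p ^ n) := hk.pow_right n
  have hx : (k : ZMod (p ^ n)) ≠ 0 := fun h => by
    have h1 := hk.symm.eq_one_of_dvd
      ((dvd_pow_self p hn.ne').trans ((ZMod.natCast_eq_zero_iff _ _).1 h))
    exact (Fact.out : p.Prime).one_lt.ne' h1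
  have hv : (oneSub hζ _ hx : pIntegers p n K) = 1 - ζ ^ k := by
    rw [oneSub_val, pow_val_natCast hζ]
  refine ⟨oneSub hζ _ hx, ?_, hv⟩
  have h1 : steinberg (rootUnit hζ ^ k) (oneSub hζ _ hx) = 0 :=
    steinberg_of_add_eq (Or.inr (by rw [hv, Units.val_pow_eq_pow_val, rootUnit_val]; ring))
  set l := ((ZMod.unitOfCoprime k hk')⁻¹ : (ZMod (p ^ n))ˣ).1.val with hl
  have h2 : rootUnit hζ = (rootUnit hζ ^ k) ^ l := by
    apply Units.ext
    rw [← pow_mul, Units.val_pow_eq_pow_val, rootUnit_val, ← pow_val_natCast hζ (k * l),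
      Nat.cast_mul, hl, ZMod.natCast_zmod_val, ← ZMod.coe_unitOfCoprime k hk', Units.mul_inv,
      ← Nat.cast_one, pow_val_natCast hζ, pow_one]
  change steinberg _ _ = 0
  rw [h2, steinberg_pow_left, h1, smul_zero]

/-- Write `x = p^s c` with `c` prime to `p`. Then `1 - ζ^x` is the product of `1 - μζ^c` over
`μ^(p^s) = 1`. Since `s < n`, each `μ` is a power of `ζ^p`, so every factor is `1 - ζ^k` with `k`
prime to `p`. -/
theorem oneSub_mem_nullUnits (x : ZMod (p ^ n)) (hx : x ≠ 0) :
    oneSub hζ x hx ∈ nullUnits (rootUnit hζ) := by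
  have hp : p.Prime := Fact.out
  have hx0 : x.val ≠ 0 := (ZMod.val_eq_zero x).not.2 hx
  obtain ⟨s, c, hc, hxc⟩ := Nat.exists_eq_pow_mul_and_not_dvd hx0 p hp.ne_one
  have hcp : c.Coprime p := ((hp.coprime_iff_not_dvd).2 hc).symm
  have hsn : s < n := by
    refine (Nat.pow_lt_pow_iff_right hp.one_lt).1 (lt_of_le_of_lt ?_ (ZMod.val_lt x))
    rw [hxc]
    exact Nat.le_mul_of_pos_right _ (Nat.pos_of_ne_zero fun h => hc (h ▸ dvd_zero p))
  have hη : IsPrimitiveRoot (ζ ^ p ^ (n - s)) (p ^ s) :=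
    hζ.pow (pow_pos hp.pos n) (by rw [← pow_add, Nat.sub_add_cancel hsn.le])
  have hprod := hη.pow_sub_pow_eq_prod_sub_mul 1 (ζ ^ c) (pow_pos hp.pos s)
  rw [one_pow, ← pow_mul, mul_comm c, ← hxc] at hprod
  have hmem : 1 - ζ ^ x.val ∈
      (nullUnits (rootUnit hζ)).toSubmonoid.map (Units.coeHom (pIntegers p n K)) := by
    rw [hprod]
    refine Submonoid.prod_mem _ fun μ hμ => ?_
    have hpos : 0 < p ^ s := pow_pos hp.pos s
    have : NeZero (p ^ s) := ⟨hpos.ne'⟩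
    obtain ⟨i, -, rfl⟩ := hη.eq_pow_of_pow_eq_one ((Polynomial.mem_nthRootsFinset hpos _).1 hμ)
    rw [← pow_mul, ← pow_add]
    refine one_sub_pow_mem_nullUnits hζ ?_ (by omega)
    obtain ⟨t, ht⟩ : ∃ t, n - s = t + 1 := ⟨n - s - 1, by omega⟩
    rw [ht, pow_succ, mul_comm _ p, mul_assoc, Nat.coprime_mul_left_add_left]
    exact hcp
  obtain ⟨u, hu, hux⟩ := hmem
  have : u = oneSub hζ x hx := Units.ext (by rw [oneSub_val]; exact hux)
  exact this ▸ hu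

theorem cycUnit_mem_nullUnits (x : ZMod (p ^ n)) : cycUnit hζ x ∈ nullUnits (rootUnit hζ) := by
  rw [cycUnit]
  split_ifs with h
  · exact oneSub_mem_nullUnits hζ x h
  · exact one_mem _

/-- The identity `1 - ζ^(-x) = -ζ^(-x) (1 - ζ^x)` makes the Manin symbol even in each variable. -/
theorem exists_cycUnit_neg (x : ZMod (p ^ n)) :
    ∃ w ∈ signedPowers (rootUnit hζ), cycUnit hζ (-x) = w * cycUnit hζ x := by
  by_cases hx : x = 0
  · exact ⟨1, one_mem _, by rw [hx, neg_zero, one_mul]⟩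
  · refine ⟨-1 * rootUnit hζ ^ (-x).val, mul_mem (neg_one_mem_signedPowers _)
      (pow_mem (self_mem_signedPowers _) _), Units.ext ?_⟩
    have h := pow_val_add hζ (-x) x
    rw [neg_add_cancel, ZMod.val_zero, pow_zero] at h
    rw [cycUnit_val hζ (neg_ne_zero.2 hx), Units.val_mul, cycUnit_val hζ hx, Units.val_mul,
      Units.val_pow_eq_pow_val, rootUnit_val, Units.val_neg, Units.val_one]
    linear_combination h

/-! ### Manin relations for Steinberg symbols of cyclotomic units. -/

theorem maninSymbol_swap (x y : ZMod (p ^ n)) : maninSymbol hζ x y = -maninSymbol hζ y x := by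
  rw [maninSymbol_eq, maninSymbol_eq, steinberg_swap]

theorem maninSymbol_neg_left (x y : ZMod (p ^ n)) :
    maninSymbol hζ (-x) y = maninSymbol hζ x y := by
  obtain ⟨w, hw, h⟩ := exists_cycUnit_neg hζ x
  rw [maninSymbol_eq, maninSymbol_eq, h, steinberg_mul_left,
    steinberg_eq_zero_of_mem hw (cycUnit_mem_nullUnits hζ y), zero_add]

theorem maninSymbol_neg_right (x y : ZMod (p ^ n)) :
    maninSymbol hζ x (-y) = maninSymbol hζ x y := by
  rw [maninSymbol_swap, maninSymbol_neg_left, ← maninSymbol_swap]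

theorem maninSymbol_zero_left (y : ZMod (p ^ n)) : maninSymbol hζ 0 y = 0 := by
  rw [maninSymbol_eq, cycUnit_zero, steinberg_one_left]

theorem maninSymbol_zero_right (x : ZMod (p ^ n)) : maninSymbol hζ x 0 = 0 := by
  rw [maninSymbol_eq, cycUnit_zero, steinberg_one_right]

theorem maninSymbol_self (x : ZMod (p ^ n)) : maninSymbol hζ x x = 0 := by
  rw [maninSymbol_eq, steinberg_self]

theorem isManin_maninSymbol : IsManin (maninSymbol hζ) where
  zero_right := maninSymbol_zero_right hζ
  two_term x y := by
    rw [maninSymbol_neg_right, maninSymbol_swap hζ y x, add_neg_cancel]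
  three_term x y := by
    by_cases hx : x = 0
    · rw [hx, zero_add, maninSymbol_self, add_zero]
    by_cases hy : y = 0
    · rw [hy, add_zero, maninSymbol_self, maninSymbol_zero_right, add_zero]
    by_cases hxy : x + y = 0
    · rw [hxy, eq_neg_of_add_eq_zero_right hxy, maninSymbol_neg_right, maninSymbol_self,
        maninSymbol_zero_right, maninSymbol_zero_left, add_zero]
    simp only [maninSymbol_eq]
    -- Uses `(1 - ζ^x) + ζ^x (1 - ζ^y) = 1 - ζ^(x+y)`.
    refine steinberg_three_term (cycUnit_mem_nullUnits hζ x) (cycUnit_mem_nullUnits hζ y)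
      (cycUnit_mem_nullUnits hζ _) (one_mem _)
      (pow_mem (self_mem_signedPowers (rootUnit hζ)) x.val) ?_
    rw [cycUnit_val hζ hx, cycUnit_val hζ hy, cycUnit_val hζ hxy, pow_val_add hζ,
      Units.val_pow_eq_pow_val, rootUnit_val, Units.val_one]
    ring

/-- The quotient `(1 - ζ ^ (k x)) / (1 - ζ ^ x)`. -/
theorem cycUnit_div_val {k : ℕ} {x : ZMod (p ^ n)} (hx : x ≠ 0) (hkx : k * x ≠ 0)
    {r : pIntegers p n K} (hr : 1 - (ζ ^ x.val) ^ k = r * (1 - ζ ^ x.val)) :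
    ((cycUnit hζ (k * x) * (cycUnit hζ x)⁻¹ : (pIntegers p n K)ˣ) : pIntegers p n K) = r := by
  have h : ζ ^ ((k : ZMod (p ^ n)) * x).val = (ζ ^ x.val) ^ k := by
    rw [← pow_mul, ← pow_val_natCast hζ (x.val * k), Nat.cast_mul, ZMod.natCast_zmod_val, mul_comm]
  rw [Units.val_mul, Units.mul_inv_eq_iff_eq_mul, cycUnit_val hζ hx, cycUnit_val hζ hkx, h, hr]

/-! ### Identities between Manin symbols for `T₂` and `T₃`. -/

omit [NumberField K] in
include hζ in
theorem pow_val_sub_mul (x y : ZMod (p ^ n)) :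
    ζ ^ (y - x).val * ζ ^ x.val = ζ ^ y.val := by
  rw [← pow_val_add hζ, sub_add_cancel]

theorem maninSymbol_sub (x y : ZMod (p ^ n)) :
    maninSymbol hζ x y = maninSymbol hζ x (y - x) + maninSymbol hζ (y - x) y := by
  have h := (isManin_maninSymbol hζ).three_term (-x) y
  rwa [maninSymbol_neg_left, maninSymbol_neg_left, neg_add_eq_sub] at h

/-- The relation behind the action of `T₂`. -/
theorem maninSymbol_T2 (x y : ZMod (p ^ n)) (hx : x ≠ 0) (hy : y ≠ 0) (hx2 : 2 * x ≠ 0)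
    (hy2 : 2 * y ≠ 0) :
    maninSymbol hζ x (2 * y) + maninSymbol hζ (2 * x) y + maninSymbol hζ (2 * x) (y - x) +
      maninSymbol hζ (y - x) (2 * y) =
    maninSymbol hζ (2 * x) (2 * y) + 2 • maninSymbol hζ x y := by
  by_cases hxy : y - x = 0
  · obtain rfl := sub_eq_zero.1 hxy
    rw [sub_self, maninSymbol_zero_left, maninSymbol_zero_right, maninSymbol_self,
      maninSymbol_self, maninSymbol_swap]
    simp
  have hab := maninSymbol_sub hζ x y
  set s := cycUnit hζ (2 * x) * (cycUnit hζ x)⁻¹ with hs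
  set t := cycUnit hζ (2 * y) * (cycUnit hζ y)⁻¹ with ht
  have hs' : (s : pIntegers p n K) = 1 + ζ ^ x.val :=
    cycUnit_div_val hζ (k := 2) hx (by exact_mod_cast hx2) (by ring)
  have ht' : (t : pIntegers p n K) = 1 + ζ ^ y.val :=
    cycUnit_div_val hζ (k := 2) hy (by exact_mod_cast hy2) (by ring)
  have hsx : cycUnit hζ (2 * x) = s * cycUnit hζ x := by rw [hs, inv_mul_cancel_right]
  have hty : cycUnit hζ (2 * y) = t * cycUnit hζ y := by rw [ht, inv_mul_cancel_right]
  have hz := pow_val_sub_mul hζ x y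
  have hw : ζ ^ (-x).val * ζ ^ x.val = 1 := by
    rw [← pow_val_add hζ, neg_add_cancel, ZMod.val_zero, pow_zero]
  -- Here `s = 1 + ζ^x` and `t = 1 + ζ^y`, so `ζ^(-x) (s - t) = 1 - ζ^(y-x)`.
  have hst : steinberg s t = steinberg s (cycUnit hζ (y - x)) + steinberg (cycUnit hζ (y - x)) t := by
    refine steinberg_three_term (z := rootUnit hζ) (u := rootUnit hζ ^ (-x).val)
      (v := -1 * rootUnit hζ ^ (-x).val)
      (mul_mem (cycUnit_mem_nullUnits hζ _) (inv_mem (cycUnit_mem_nullUnits hζ _)))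
      (mul_mem (cycUnit_mem_nullUnits hζ _) (inv_mem (cycUnit_mem_nullUnits hζ _)))
      (cycUnit_mem_nullUnits hζ _) (pow_mem (self_mem_signedPowers _) _)
      (mul_mem (neg_one_mem_signedPowers _) (pow_mem (self_mem_signedPowers _) _)) ?_
    rw [hs', ht', cycUnit_val hζ hxy, Units.val_mul, Units.val_pow_eq_pow_val, rootUnit_val,
      Units.val_neg, Units.val_one, ← hz]
    linear_combination (1 - ζ ^ (y - x).val) * hw
  simp only [maninSymbol_eq] at hab
  simp only [maninSymbol_eq, hsx, hty, steinberg_mul_left, steinberg_mul_right]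
  rw [hst, hab]
  abel

/-- The relation behind the action of `T₃`. -/
theorem maninSymbol_T3 (x y : ZMod (p ^ n)) (hx : x ≠ 0) (hy : y ≠ 0) (hx3 : 3 * x ≠ 0)
    (hy3 : 3 * y ≠ 0) :
    maninSymbol hζ x (3 * y) + maninSymbol hζ (3 * x) y +
      (maninSymbol hζ (3 * x) (y - x) + maninSymbol hζ (y - x) (3 * y)) +
      (maninSymbol hζ (3 * x) (x + y) + maninSymbol hζ (x + y) (3 * y)) =
    maninSymbol hζ (3 * x) (3 * y) + 3 • maninSymbol hζ x y := by
  by_cases hxy : y - x = 0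
  · obtain rfl := sub_eq_zero.1 hxy
    rw [sub_self, maninSymbol_zero_left, maninSymbol_zero_right, maninSymbol_self,
      maninSymbol_self, maninSymbol_swap, maninSymbol_swap hζ (y + y)]
    simp
  by_cases hxy' : x + y = 0
  · obtain rfl := eq_neg_of_add_eq_zero_right hxy'
    simp only [add_neg_cancel, mul_neg, maninSymbol_neg_right, maninSymbol_zero_left,
      maninSymbol_zero_right, maninSymbol_self]
    rw [maninSymbol_swap hζ x, maninSymbol_swap hζ (-x - x)]
    simp
  have hab := maninSymbol_sub hζ x y
  have hab' := (isManin_maninSymbol hζ).three_term x y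
  set s := cycUnit hζ (3 * x) * (cycUnit hζ x)⁻¹ with hs
  set t := cycUnit hζ (3 * y) * (cycUnit hζ y)⁻¹ with ht
  have hs' : (s : pIntegers p n K) = 1 + ζ ^ x.val + (ζ ^ x.val) ^ 2 :=
    cycUnit_div_val hζ (k := 3) hx (by exact_mod_cast hx3) (by ring)
  have ht' : (t : pIntegers p n K) = 1 + ζ ^ y.val + (ζ ^ y.val) ^ 2 :=
    cycUnit_div_val hζ (k := 3) hy (by exact_mod_cast hy3) (by ring)
  have hsx : cycUnit hζ (3 * x) = s * cycUnit hζ x := by rw [hs, inv_mul_cancel_right]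
  have hty : cycUnit hζ (3 * y) = t * cycUnit hζ y := by rw [ht, inv_mul_cancel_right]
  have hz := pow_val_sub_mul hζ x y
  -- With `X = ζ^x` and `Y = ζ^y`, the identity is `(1 + Y + Y²) - (Y/X)(1 + X + X²) = (1 - Y/X)(1 -
  -- XY)`.
  have hst : steinberg s t = steinberg s (cycUnit hζ (y - x) * cycUnit hζ (x + y)) +
      steinberg (cycUnit hζ (y - x) * cycUnit hζ (x + y)) t := by
    refine steinberg_three_term (z := rootUnit hζ) (u := -1 * rootUnit hζ ^ (y - x).val) (v := 1)
      (mul_mem (cycUnit_mem_nullUnits hζ _) (inv_mem (cycUnit_mem_nullUnits hζ _)))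
      (mul_mem (cycUnit_mem_nullUnits hζ _) (inv_mem (cycUnit_mem_nullUnits hζ _)))
      (mul_mem (cycUnit_mem_nullUnits hζ _) (cycUnit_mem_nullUnits hζ _))
      (mul_mem (neg_one_mem_signedPowers _) (pow_mem (self_mem_signedPowers _) _))
      (one_mem _) ?_
    rw [hs', ht', Units.val_mul (cycUnit hζ _), cycUnit_val hζ hxy, cycUnit_val hζ hxy',
      Units.val_mul, Units.val_pow_eq_pow_val, rootUnit_val, Units.val_neg, Units.val_one,
      pow_val_add hζ, ← hz]
    ring
  simp only [maninSymbol_eq] at hab hab'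
  simp only [maninSymbol_eq, hsx, hty, steinberg_mul_left, steinberg_mul_right] at hst ⊢
  rw [hst]
  -- The three copies are written differently: one unchanged, one split at `y - x`, one split at `x
  -- + y`, to match the factors of the product.
  have h3 : 3 • steinberg (cycUnit hζ x) (cycUnit hζ y) =
      steinberg (cycUnit hζ x) (cycUnit hζ y) +
      (steinberg (cycUnit hζ x) (cycUnit hζ (y - x)) +
        steinberg (cycUnit hζ (y - x)) (cycUnit hζ y)) +
      (steinberg (cycUnit hζ x) (cycUnit hζ (x + y)) +
        steinberg (cycUnit hζ (x + y)) (cycUnit hζ y)) := by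
    rw [← hab, ← hab']
    abel
  rw [h3]
  abel

/-! ### Galois action on Manin symbols -/

variable [IsCyclotomicExtension {p ^ n} ℚ K]

theorem galRing_cycUnit (a : (ZMod (p ^ n))ˣ) (x : ZMod (p ^ n)) :
    Units.map (galRing p n K (galOf p n K a) : pIntegers p n K →* pIntegers p n K)
      (cycUnit hζ x) = cycUnit hζ (a * x) := by
  by_cases hx : x = 0
  · rw [hx, mul_zero, cycUnit_zero, map_one]
  · have hax : (a : ZMod (p ^ n)) * x ≠ 0 := fun h => hx (a.isUnit.mul_right_eq_zero.1 h)
    have hζa : galRing p n K (galOf p n K a) ζ = ζ ^ (a : ZMod (p ^ n)).val := by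
      apply Subtype.ext
      change galOf p n K a (ζ : K) = _
      rw [galOf_apply, SubmonoidClass.coe_pow]
      rw [← SubmonoidClass.coe_pow, hζ.pow_eq_one]
      rfl
    apply Units.ext
    rw [Units.coe_map, cycUnit_val hζ hx, cycUnit_val hζ hax, mul_comm, pow_val_mul hζ]
    change galRing p n K (galOf p n K a) (1 - ζ ^ x.val) = _
    rw [map_sub, map_one, map_pow, hζa]

theorem galRep_maninSymbol (a : (ZMod (p ^ n))ˣ) (x y : ZMod (p ^ n)) :
    galRep p n K (galOf p n K a) (maninSymbol hζ x y) = maninSymbol hζ (a * x) (a * y) := by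
  rw [maninSymbol_eq, maninSymbol_eq, ← galRing_cycUnit hζ, ← galRing_cycUnit hζ]
  rfl

theorem isEquivariant_maninSymbol : IsEquivariant (artinRep p n K) (maninSymbol hζ) :=
  fun δ x y => galRep_maninSymbol hζ (upperLeft (p ^ n) δ) x y

/-! ### Existence, uniqueness and Hecke action for the Steinberg modular symbol. -/

theorem exists_isSteinbergSymb : ∃ φ : Symb (artinRep p n K), IsSteinbergSymb hζ φ := by
  have h1 := isManin_maninSymbol hζ
  have h2 := isEquivariant_maninSymbol hζ
  exact exists_symb (ρ := artinRep p n K) (e := maninSymbol hζ) h1 h2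

variable {hζ} in
theorem IsSteinbergSymb.unique {φ ψ : Symb (artinRep p n K)} (hψ : IsSteinbergSymb hζ ψ)
    (hφ : IsSteinbergSymb hζ φ) : ψ = φ :=
  Subtype.ext (hom_ext_unimodular fun γ => (hψ γ).trans (hφ γ).symm)

theorem isCoprime_prime_pow {q : ℕ} (hq : q.Prime) (h : p ≠ q) :
    IsCoprime (q : ℤ) ((p ^ n : ℕ) : ℤ) :=
  Nat.isCoprime_iff_coprime.2
    (Nat.Coprime.pow_right n ((Nat.coprime_primes hq Fact.out).2 h.symm))

theorem natCast_mul_ne_zero {q : ℕ} (hq : q.Prime) (h : p ≠ q) {x : ZMod (p ^ n)} (hx : x ≠ 0) :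
    (q : ZMod (p ^ n)) * x ≠ 0 := fun h0 =>
  hx ((primeUnit p n q hq h).isUnit.mul_right_eq_zero.1 h0)

theorem sum_valMinAbs_two {M : Type} [AddCommMonoid M] [Fintype (ZMod 2)] (g : ℤ → M) :
    ∑ j : ZMod 2, g j.valMinAbs = g 0 + g 1 := by
  rw [Fintype.sum_equiv (show ZMod 2 ≃ Fin 2 from Equiv.refl _) (fun j => g j.valMinAbs)
    (fun j : Fin 2 => g (ZMod.valMinAbs (n := 2) j)) fun _ => rfl, Fin.sum_univ_two]
  rfl

theorem sum_valMinAbs_three {M : Type} [AddCommMonoid M] [Fintype (ZMod 3)] (g : ℤ → M) :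
    ∑ j : ZMod 3, g j.valMinAbs = g 0 + g 1 + g (-1) := by
  rw [Fintype.sum_equiv (show ZMod 3 ≃ Fin 3 from Equiv.refl _) (fun j => g j.valMinAbs)
    (fun j : Fin 3 => g (ZMod.valMinAbs (n := 3) j)) fun _ => rfl, Fin.sum_univ_three]
  rfl

theorem heckeT_two (φ : Symb (artinRep p n K)) (hφ : IsSteinbergSymb hζ φ) (h : p ≠ 2) :
    heckeT (artinRep p n K) 2 two_pos (symbToPar _ φ) =
      galPar p n K (galOf p n K (primeUnit p n 2 Nat.prime_two h)) (symbToPar _ φ) +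
        2 • symbToPar _ φ := by
  have : Fact (Nat.Prime 2) := ⟨Nat.prime_two⟩
  refine heckeT_symbToPar two_pos (isEquivariant_maninSymbol hζ) φ hφ
    (isCoprime_prime_pow Nat.prime_two h) (by decide) _ (galRep_artinRep p n K _)
    (galRep_maninSymbol hζ (primeUnit p n 2 Nat.prime_two h))
    -- The error function is the only term left when `x = 0`, namely `e(y, -2y)` from the residue `j
    -- = 1`; at `y = 0` the surviving term is its negative by antisymmetry.
    (fun y => maninSymbol hζ y (2 * y)) (fun δ y => ?_) (fun y => ?_) fun x y => ?_
  · rw [isEquivariant_maninSymbol, mul_left_comm]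
  · rw [mul_neg, maninSymbol_neg_left, maninSymbol_neg_right]
  · rw [sum_valMinAbs_two fun j : ℤ => maninSymbol hζ ((2 : ℕ) * x) (y - j * x) +
      if j = 0 then 0 else maninSymbol hζ (y - j * x) (-(j * (2 : ℕ) * y))]
    simp only [Int.cast_zero, Int.cast_one, zero_mul, one_mul, sub_zero, if_true, one_ne_zero,
      if_false, add_zero, Nat.cast_ofNat, maninSymbol_neg_right]
    by_cases hx : x = 0
    · by_cases hy : y = 0 <;>
        simp [hx, hy, maninSymbol_zero_left, maninSymbol_zero_right]
    by_cases hy : y = 0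
    · rw [maninSymbol_swap hζ x (2 * x)]
      simp [hx, hy, maninSymbol_zero_right, maninSymbol_neg_right]
    rw [if_neg hx, if_neg hy, sub_zero, add_zero, ← maninSymbol_T2 hζ x y hx hy
      (by exact_mod_cast natCast_mul_ne_zero Nat.prime_two h hx)
      (by exact_mod_cast natCast_mul_ne_zero Nat.prime_two h hy)]
    abel

theorem heckeT_three (φ : Symb (artinRep p n K)) (hφ : IsSteinbergSymb hζ φ) (h : p ≠ 3) :
    heckeT (artinRep p n K) 3 three_pos (symbToPar _ φ) =
      galPar p n K (galOf p n K (primeUnit p n 3 Nat.prime_three h)) (symbToPar _ φ) +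
        3 • symbToPar _ φ := by
  have : Fact (Nat.Prime 3) := ⟨Nat.prime_three⟩
  refine heckeT_symbToPar three_pos (isEquivariant_maninSymbol hζ) φ hφ
    (isCoprime_prime_pow Nat.prime_three h) (by decide) _ (galRep_artinRep p n K _)
    (galRep_maninSymbol hζ (primeUnit p n 3 Nat.prime_three h))
    -- The factor `2` comes from the residues `j = 1` and `j = -1`, which contribute equally at `x =
    -- 0` because `e` is even.
    (fun y => 2 • maninSymbol hζ y (3 * y)) (fun δ y => ?_) (fun y => ?_) fun x y => ?_
  · rw [map_nsmul, isEquivariant_maninSymbol, mul_left_comm]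
  · rw [mul_neg, maninSymbol_neg_left, maninSymbol_neg_right]
  · rw [sum_valMinAbs_three fun j : ℤ => maninSymbol hζ ((3 : ℕ) * x) (y - j * x) +
      if j = 0 then 0 else maninSymbol hζ (y - j * x) (-(j * (3 : ℕ) * y))]
    simp only [Int.cast_zero, Int.cast_one, Int.cast_neg, zero_mul, one_mul, neg_mul, sub_zero,
      sub_neg_eq_add, if_true, one_ne_zero, neg_eq_zero, if_false, add_zero, Nat.cast_ofNat,
      maninSymbol_neg_right]
    by_cases hx : x = 0
    · by_cases hy : y = 0 <;>
        simp [hx, hy, maninSymbol_zero_left, maninSymbol_zero_right, two_smul]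
    by_cases hy : y = 0
    · rw [maninSymbol_swap hζ x (3 * x)]
      simp [hx, hy, maninSymbol_zero_right, maninSymbol_neg_right, two_smul]
    rw [if_neg hx, if_neg hy, sub_zero, add_zero, ← maninSymbol_T3 hζ x y hx hy
      (by exact_mod_cast natCast_mul_ne_zero Nat.prime_three h hx)
      (by exact_mod_cast natCast_mul_ne_zero Nat.prime_three h hy), add_comm x y]
    abel

end Cyclotomic

end SteinbergSymbol

end

theorem theorem1p1 (p : ℕ) [Fact p.Prime] (n : ℕ) (hn : 0 < n)
    (K : Type) [Field K] [NumberField K] [IsCyclotomicExtension {p ^ n} ℚ K]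
    (ζ : SteinbergSymbol.pIntegers p n K) (hζ : IsPrimitiveRoot ζ (p ^ n)) :
    ∃ φ : SteinbergSymbol.Symb (SteinbergSymbol.artinRep p n K),
      SteinbergSymbol.IsSteinbergSymb hζ φ ∧
      (∀ ψ, SteinbergSymbol.IsSteinbergSymb hζ ψ → ψ = φ) ∧
      (∀ h : p ≠ 2,
        SteinbergSymbol.heckeT (SteinbergSymbol.artinRep p n K) 2 two_pos
            (SteinbergSymbol.symbToPar _ φ) =
          SteinbergSymbol.galPar p n K
              (SteinbergSymbol.galOf p n K (SteinbergSymbol.primeUnit p n 2 Nat.prime_two h))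
              (SteinbergSymbol.symbToPar _ φ) +
            2 • SteinbergSymbol.symbToPar _ φ) ∧
      (∀ h : p ≠ 3,
        SteinbergSymbol.heckeT (SteinbergSymbol.artinRep p n K) 3 three_pos
            (SteinbergSymbol.symbToPar _ φ) =
          SteinbergSymbol.galPar p n K
              (SteinbergSymbol.galOf p n K (SteinbergSymbol.primeUnit p n 3 Nat.prime_three h))
              (SteinbergSymbol.symbToPar _ φ) +
            3 • SteinbergSymbol.symbToPar _ φ) := by
  refine (SteinbergSymbol.exists_isSteinbergSymb hζ).imp fun φ hφ => ?_
  exact ⟨hφ, fun ψ hψ => hψ.unique hφ, SteinbergSymbol.heckeT_two hζ φ hφ,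
    SteinbergSymbol.heckeT_three hζ φ hφ⟩
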